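/- Let $M$ be a smooth manifold of dimension $m$ (Hausdorff, second countable, without boundary) and let $(A,[\,,\,],\rho)$ be a Lie algebroid of rank $n$ over $M$, with differential $\mathrm{d}$ on $\Omega^\bullet(A)=\Gamma(\wedge^\bullet A^*)$ and Lie derivative $\mathcal L$. Let $\mu$ be a volume form on $M$, and let $\eta\in\Gamma(\wedge^nA)$ and $\nu\in\Gamma(\wedge^nA^*)$ satisfy $\langle\nu,\eta\rangle=1$. Conventions. For a bivector $P\in\Gamma(\wedge^2A)$, $P^\sharp:A^*\to A$ is given by $\langle\beta,P^\sharp\alpha\rangle=P(\alpha,\beta)$, and $i_P$ is the interior product determined by $i_{X\wedge Y}=i_X\circ i_Y$. The Schouten bracket satisfies $[P,Q\wedge R]=[P,Q]\wedge R+(-1)^{(p-1)q}Q\wedge[P,R]$. The modular form of a Lie algebroid $B$ with anchor $\rho_B$, with respect to $\sigma\otimes\mu$ where $\sigma$ is a nowhere vanishing section of $\wedge^{\mathrm{top}}B$, is the unique $\xi_B^{\sigma\otimes\mu}\in\Gamma(B^*)$ such that $$\langle\xi_B^{\sigma\otimes\mu},X\rangle\,\sigma\otimes\mu=\mathcal L_X\sigma\otimes\mu+\sigma\otimes\mathcal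 L_{\rho_B(X)}\mu\qquad(X\in\Gamma(B)).$$ For a $1$-cocycle $\phi$ of $B$, the modular form of the Jacobi algebroid $(B,\phi)$ is $\xi_B^{\phi,\sigma\otimes\mu}=\xi_B^{\sigma\otimes\mu}-(\operatorname{rank}B-1)\phi$. (a) Let $P\in\Gamma(\wedge^2A)$ satisfy $[P,P]=0$, so that $A$ and $A^*$, with the bracket $[\alpha,\beta]_P=\mathcal L_{P^\sharp\alpha}\beta-\mathcal L_{P^\sharp\beta}\alpha-\mathrm d(P(\alpha,\beta))$ and the anchor $\rho\circ P^\sharp$, form a triangular Lie bialgebroid. Then the modular forms $\xi_A^{\eta\otimes\mu}$ and $\xi_{A^*}^{\nu\otimes\mu}$ exist, are unique, and satisfy $$P^\sharp\xi_A^{\eta\otimes\mu}(\alpha)=-\xi_{A^*}^{\nu\otimes\mu}(\alpha)-2\langle\alpha\wedge\mathrm d\,i_P\nu,\eta\rangle,\qquad\alpha\in\Omega^1(A).$$ (b) Let $\phi_0\in\Omega^1(A)$ with $\mathrm d\phi_0=0$ and let $P\in\Gamma(\wedge^2A)$ be a Jacobi bivector, $[P,P]^{\phi_0}=[P,P]+P\wedge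 P^\sharp\phi_0+P^\sharp\phi_0\wedge P=0$. Put $X_0=-P^\sharp\phi_0$ and give $A^*$ the anchor $\rho\circ P^\sharp$ and the bracket $[\alpha,\beta]_P=\mathcal L^{\phi_0}_{P^\sharp\alpha}\beta-\mathcal L^{\phi_0}_{P^\sharp\beta}\alpha-\mathrm d^{\phi_0}(P(\alpha,\beta))$, where $\mathrm d^{\phi_0}f=\mathrm df+f\phi_0$ and $\mathcal L^{\phi_0}_X\beta=\mathcal L_X\beta+\langle\phi_0,X\rangle\beta$. Then the modular form $\xi_{A^*}^{\nu\otimes\mu}$ exists, is unique, and the modular forms of the Jacobi algebroids $(A,\phi_0)$ and $(A^*,X_0)$ satisfy, for all $\alpha\in\Omega^1(A)$, $$P^\sharp\xi_A^{\eta\otimes\mu}(\alpha)=-\xi_{A^*}^{X_0,\nu\otimes\mu}(\alpha)-\langle\alpha,X_0\rangle-2\langle\alpha\wedge\mathrm d\,i_P\nu,\eta\rangle,$$ $$P^\sharp\xi_A^{\eta\otimes\mu}(\alpha)=-\xi_{A^*}^{\nu\otimes\mu}(\alpha)+(n-2)\langle\alpha,X_0\rangle-2\langle\alpha\wedge\mathrm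 d\,i_P\nu,\eta\rangle,$$ $$P^\sharp\xi_A^{\phi_0,\eta\otimes\mu}(\alpha)=-\xi_{A^*}^{X_0,\nu\otimes\mu}(\alpha)+(n-2)\langle\alpha,X_0\rangle-2\langle\alpha\wedge\mathrm d\,i_P\nu,\eta\rangle.$$ -/

import Mathlib

open scoped Manifold ContDiff TensorProduct
open Bundle

set_option linter.unusedSectionVars false

noncomputable section

namespace LieAlgd

/-! ## Cartan calculus of a (skew) Lie-Rinehart structure

`C` is the algebra of functions and `E` the module of sections of the vector bundle.
Multivectors of degree `k` are the elements of `⋀[C]^k E`, forms of degree `k` are the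
alternating `C`-multilinear maps `E [⋀^Fin k]→ₗ[C] C`; one-forms are also written as elements of
`Module.Dual C E`. -/

section Algebra

variable {C : Type*} [CommRing C] [Algebra ℝ C]
variable {E : Type*} [AddCommGroup E] [Module C E]
variable {N : Type*} [AddCommGroup N] [Module C N]

/-! ### Sums over slots -/

/-- `∑ i, g (v 0, …, δ (v i), …, v (k - 1))`. -/
def slotSum {k : ℕ} (g : E [⋀^Fin k]→ₗ[C] N) (δ : E → E) (v : Fin k → E) : N :=
  ∑ i, g (Function.update v i (δ (v i)))

theorem slotSum_update_add {k : ℕ} (g : E [⋀^Fin k]→ₗ[C] N) {δ : E → E}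
    (hδ : ∀ x y, δ (x + y) = δ x + δ y) (v : Fin k → E) (j : Fin k) (x y : E) :
    slotSum g δ (Function.update v j (x + y)) =
      slotSum g δ (Function.update v j x) + slotSum g δ (Function.update v j y) := by
  unfold slotSum
  rw [← Finset.sum_add_distrib]
  refine Finset.sum_congr rfl fun i _ => ?_
  by_cases h : i = j
  · subst h
    simp [hδ]
  · simp only [Function.update_of_ne h, Function.update_comm (Ne.symm h)]
    exact g.map_update_add _ _ _ _

theorem slotSum_update_smul {k : ℕ} (g : E [⋀^Fin k]→ₗ[C] N) {δ : E → E} {D : C → C}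
    (hδ : ∀ (f : C) x, δ (f • x) = f • δ x + D f • x) (v : Fin k → E) (j : Fin k) (f : C) (x : E) :
    slotSum g δ (Function.update v j (f • x)) =
      f • slotSum g δ (Function.update v j x) + D f • g (Function.update v j x) := by
  unfold slotSum
  rw [Finset.smul_sum, ← Finset.add_sum_erase _ _ (Finset.mem_univ j),
    ← Finset.add_sum_erase _ _ (Finset.mem_univ j)]
  have h1 : ∀ i ∈ Finset.univ.erase j,
      g (Function.update (Function.update v j (f • x)) i
        (δ (Function.update v j (f • x) i))) =
      f • g (Function.update (Function.update v j x) i (δ (Function.update v j x i))) := by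
    intro i hi
    have h : i ≠ j := Finset.ne_of_mem_erase hi
    simp only [Function.update_of_ne h, Function.update_comm (Ne.symm h)]
    exact g.map_update_smul _ _ _ _
  rw [Finset.sum_congr rfl h1]
  simp only [Function.update_self, Function.update_idem, hδ]
  rw [g.map_update_add, g.map_update_smul, g.map_update_smul]
  abel

theorem slotSum_eq_zero {k : ℕ} (g : E [⋀^Fin k]→ₗ[C] N) (δ : E → E) (v : Fin k → E)
    {i j : Fin k} (hv : v i = v j) (hij : i ≠ j) : slotSum g δ v = 0 := by
  unfold slotSum
  rw [Fintype.sum_eq_add i j hij]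
  · have : Function.update v j (δ (v j)) = Function.update v i (δ (v i)) ∘ Equiv.swap i j := by
      ext l
      by_cases hi : l = i
      · subst hi; simp [hv, hij, Function.update_of_ne hij.symm]
      · by_cases hj : l = j
        · subst hj; simp [hv]
        · simp [Equiv.swap_apply_of_ne_of_ne hi hj, hi, hj]
    rw [this, g.map_swap _ hij]
    abel
  · intro l hl
    refine g.map_eq_zero_of_eq _ ?_ hij
    rw [Function.update_of_ne hl.1.symm, Function.update_of_ne hl.2.symm, hv]

/-! ### Skew algebroids -/

variable (C E) in
/-- A skew bracket on the module `E` with an anchor `act` by derivations of `C` satisfying the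
Leibniz rule. It carries all that is needed to define Lie derivatives and differentials; the
Jacobi identity is part of `LieAlgebroid` below. -/
structure SkewAlgebroid where
  bracket : E → E → E
  act : E →ₗ[C] Derivation ℝ C C
  bracket_add_right : ∀ X Y Z, bracket X (Y + Z) = bracket X Y + bracket X Z
  bracket_self : ∀ X, bracket X X = 0
  bracket_add_left : ∀ X Y Z, bracket (X + Y) Z = bracket X Z + bracket Y Z
  bracket_smul : ∀ X (f : C) Y, bracket X (f • Y) = f • bracket X Y + act X f • Y

namespace SkewAlgebroid

variable (S : SkewAlgebroid C E)

theorem bracket_swap (X Y : E) : S.bracket X Y = -S.bracket Y X := by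
  have h := S.bracket_self (X + Y)
  rw [S.bracket_add_left, S.bracket_add_right, S.bracket_add_right, S.bracket_self,
    S.bracket_self] at h
  rw [eq_neg_iff_add_eq_zero]
  simpa using h

theorem bracket_smul_left (f : C) (X Y : E) :
    S.bracket (f • X) Y = f • S.bracket X Y - S.act Y f • X := by
  rw [S.bracket_swap, S.bracket_smul, S.bracket_swap Y X]
  simp
  abel

/-- The differential of a function, `⟨df, X⟩ = ρ(X) f`. -/
def dFun (f : C) : Module.Dual C E where
  toFun X := S.act X f
  map_add' X Y := by simp
  map_smul' c X := by simp

/-- Lie derivative of a `k`-form: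
`(L_X τ)(Y₁, …, Y_k) = ρ(X)(τ(Y₁, …, Y_k)) - ∑ i, τ(Y₁, …, [X, Y_i], …, Y_k)`. -/
def lieForm (X : E) {k : ℕ} (τ : E [⋀^Fin k]→ₗ[C] C) : E [⋀^Fin k]→ₗ[C] C where
  toFun v := S.act X (τ v) - slotSum τ (S.bracket X) v
  map_update_add' v j x y := by
    have : ‹DecidableEq (Fin k)› = instDecidableEqFin k := Subsingleton.elim _ _
    subst this
    rw [slotSum_update_add _ (S.bracket_add_right X), τ.map_update_add, map_add]
    abel
  map_update_smul' v j f x := by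
    have : ‹DecidableEq (Fin k)› = instDecidableEqFin k := Subsingleton.elim _ _
    subst this
    rw [slotSum_update_smul _ (S.bracket_smul X), τ.map_update_smul, smul_eq_mul,
      Derivation.leibniz]
    simp only [smul_eq_mul]
    ring
  map_eq_zero_of_eq' v i j hv hij := by
    rw [slotSum_eq_zero _ _ _ hv hij, τ.map_eq_zero_of_eq _ hv hij, map_zero, sub_zero]

theorem lieForm_apply (X : E) {k : ℕ} (τ : E [⋀^Fin k]→ₗ[C] C) (v : Fin k → E) :
    S.lieForm X τ v =
      S.act X (τ v) - ∑ i, τ (Function.update v i (S.bracket X (v i))) := rfl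

/-- The Lie derivative of a one-form, `⟨L_X β, Y⟩ = ρ(X)⟨β, Y⟩ - ⟨β, [X, Y]⟩`. -/
def lieOne (X : E) (β : Module.Dual C E) : Module.Dual C E where
  toFun Y := S.act X (β Y) - β (S.bracket X Y)
  map_add' Y Z := by rw [S.bracket_add_right]; simp; abel
  map_smul' f Y := by rw [S.bracket_smul]; simp; ring

/-! ### exterior differential -/


/-- Auxiliary additive version of one summand of `d`. -/
def preDAux (X : E) {k : ℕ} (τ : E [⋀^Fin k]→ₗ[C] C) : E [⋀^Fin k]→ₗ[ℤ] C where
  toMultilinearMap :=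
    (S.lieForm X τ).toMultilinearMap.restrictScalars ℤ +
      (S.act X : C →+ C).toIntLinearMap.compMultilinearMap
        (τ.toMultilinearMap.restrictScalars ℤ)
  map_eq_zero_of_eq' v i j hv hij := by
    have h1 := (S.lieForm X τ).map_eq_zero_of_eq v hv hij
    have h2 := τ.map_eq_zero_of_eq v hv hij
    simp [h1, h2]

theorem preDAux_apply (X : E) {k : ℕ} (τ : E [⋀^Fin k]→ₗ[C] C) (v : Fin k → E) :
    S.preDAux X τ v = S.lieForm X τ v + S.act X (τ v) := rfl

/-- Twice the differential, as an additive alternating map. -/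
def preD {k : ℕ} (τ : E [⋀^Fin k]→ₗ[C] C) : E [⋀^Fin (k + 1)]→ₗ[ℤ] C :=
  AlternatingMap.alternatizeUncurryFin (R := ℤ)
    (AddMonoidHom.toIntLinearMap (AddMonoidHom.mk' (fun X => S.preDAux X τ) (by
      intro X Y
      ext v
      simp only [preDAux_apply, lieForm_apply, S.bracket_add_left, AlternatingMap.add_apply,
        AlternatingMap.map_update_add, Finset.sum_add_distrib, map_add, Derivation.add_apply]
      abel)))

theorem preD_apply {k : ℕ} (τ : E [⋀^Fin k]→ₗ[C] C) (v : Fin (k + 1) → E) :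
    S.preD τ v = ∑ i : Fin (k + 1), (-1 : C) ^ (i : ℕ) *
      (S.lieForm (v i) τ (i.removeNth v) + S.act (v i) (τ (i.removeNth v))) := by
  rw [preD, AlternatingMap.alternatizeUncurryFin_apply]
  refine Finset.sum_congr rfl fun i _ => ?_
  simp [zsmul_eq_mul, preDAux_apply, mul_add]

theorem lieForm_smul_left (f : C) (X : E) {k : ℕ} (τ : E [⋀^Fin k]→ₗ[C] C) (v : Fin k → E) :
    S.lieForm (f • X) τ v = f * S.lieForm X τ v +
      ∑ l, S.act (v l) f * τ (Function.update v l X) := by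
  simp only [lieForm_apply, S.bracket_smul_left, AlternatingMap.map_update_sub,
    AlternatingMap.map_update_smul, Finset.sum_sub_distrib, mul_sub, Finset.mul_sum]
  simp [smul_eq_mul]
  ring

theorem preD_update_smul {k : ℕ} (τ : E [⋀^Fin k]→ₗ[C] C) (v : Fin (k + 1) → E)
    (j : Fin (k + 1)) (f : C) (x : E) :
    S.preD τ (Function.update v j (f • x)) = f * S.preD τ (Function.update v j x) := by
  have key : ∀ l : Fin k, (-1 : C) ^ (j : ℕ) * τ (Function.update (j.removeNth v) l x) +
      (-1 : C) ^ (j.succAbove l : ℕ) *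
        τ ((j.succAbove l).removeNth (Function.update v j x)) = 0 := by
    intro l
    have hne : j.succAbove l ≠ j := Fin.succAbove_ne j l
    have h := τ.neg_one_pow_smul_map_removeNth_add_eq_zero_of_eq
      (v := Function.update (Function.update v j x) (j.succAbove l) x) (i := j)
      (j := j.succAbove l) (by simp [Function.update_of_ne hne.symm]) hne.symm
    have e1 : j.removeNth (Function.update (Function.update v j x) (j.succAbove l) x) =
        Function.update (j.removeNth v) l x := by
      rw [Function.update_comm hne.symm]
      simp
    have e2 : (j.succAbove l).removeNth
        (Function.update (Function.update v j x) (j.succAbove l) x) =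
        (j.succAbove l).removeNth (Function.update v j x) := by
      simp
    rw [e1, e2] at h
    simpa [smul_eq_mul] using h
  have hne : ∀ l : Fin k, j.succAbove l ≠ j := Fin.succAbove_ne j
  have hrem : ∀ l : Fin k, ∃ p : Fin k, ∀ y : E,
      (j.succAbove l).removeNth (Function.update v j y) =
        Function.update ((j.succAbove l).removeNth v) p y := by
    intro l
    obtain ⟨p, hp⟩ := Fin.exists_succAbove_eq (hne l).symm
    refine ⟨p, fun y => ?_⟩
    have h := Fin.removeNth_update_succAbove (j.succAbove l) p y v
    rwa [hp] at h
  rw [preD_apply, preD_apply, Fin.sum_univ_succAbove _ j, Fin.sum_univ_succAbove _ j]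
  simp only [Function.update_self, Fin.removeNth_update, Function.update_of_ne (hne _)]
  rw [S.lieForm_smul_left]
  have hterm : ∀ l : Fin k,
      (-1 : C) ^ (j.succAbove l : ℕ) *
        (S.lieForm (v (j.succAbove l)) τ
            ((j.succAbove l).removeNth (Function.update v j (f • x))) +
          S.act (v (j.succAbove l))
            (τ ((j.succAbove l).removeNth (Function.update v j (f • x))))) =
      f * ((-1 : C) ^ (j.succAbove l : ℕ) *
        (S.lieForm (v (j.succAbove l)) τ
            ((j.succAbove l).removeNth (Function.update v j x)) +
          S.act (v (j.succAbove l)) (τ ((j.succAbove l).removeNth (Function.update v j x))))) -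
      (-1 : C) ^ (j : ℕ) *
        (S.act (v (j.succAbove l)) f * τ (Function.update (j.removeNth v) l x)) := by
    intro l
    have hk := key l
    obtain ⟨p, hp⟩ := hrem l
    simp only [hp, AlternatingMap.map_update_smul, smul_eq_mul, Derivation.leibniz] at hk ⊢
    linear_combination (S.act (v (j.succAbove l)) f) * hk
  rw [Finset.sum_congr rfl fun l _ => hterm l, Finset.sum_sub_distrib, ← Finset.mul_sum,
    ← Finset.mul_sum]
  simp only [LinearMap.map_smul, Derivation.coe_smul, Pi.smul_apply, smul_eq_mul,
    Fin.removeNth_apply]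
  ring

/-- The differential of the algebroid on `k`-forms. It is written as
`½ ∑ i, (-1)^i (L_{X_i} τ + ρ(X_i) τ)(X₀, …, omit X_i, …, X_k)`: each bracket term occurs twice in
the sum. The theorem `d_apply` shows that this is the usual (Koszul) formula. -/
def d {k : ℕ} (τ : E [⋀^Fin k]→ₗ[C] C) : E [⋀^Fin (k + 1)]→ₗ[C] C where
  toFun v := (1 / 2 : ℝ) • ∑ i : Fin (k + 1), (-1 : C) ^ (i : ℕ) *
      (S.lieForm (v i) τ (i.removeNth v) + S.act (v i) (τ (i.removeNth v)))
  map_update_add' v j x y := by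
    have : ‹DecidableEq (Fin (k + 1))› = instDecidableEqFin (k + 1) := Subsingleton.elim _ _
    subst this
    simp only [← preD_apply, AlternatingMap.map_update_add, smul_add]
  map_update_smul' v j f x := by
    have : ‹DecidableEq (Fin (k + 1))› = instDecidableEqFin (k + 1) := Subsingleton.elim _ _
    subst this
    simp only [← preD_apply, preD_update_smul, smul_eq_mul, mul_smul_comm]
  map_eq_zero_of_eq' v i j hv hij := by
    simp only [← preD_apply]
    rw [(S.preD τ).map_eq_zero_of_eq v hv hij, smul_zero]

theorem d_eq {k : ℕ} (τ : E [⋀^Fin k]→ₗ[C] C) (v : Fin (k + 1) → E) :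
    S.d τ v = (1 / 2 : ℝ) • ∑ i : Fin (k + 1), (-1 : C) ^ (i : ℕ) *
      (S.lieForm (v i) τ (i.removeNth v) + S.act (v i) (τ (i.removeNth v))) := rfl

/-- The Koszul formula
`dτ(X₀, …) = ∑ i, (-1)^i ρ(X_i)(τ(…)) + ∑ i < j, (-1)^(i+j) τ([X_i, X_j], …)`. The pair `(i, j)`
with `i ≤ j` below encodes the pair `(i, j + 1)`, whence the sign in front of the double sum. -/
theorem d_apply {k : ℕ} (τ : E [⋀^Fin (k + 1)]→ₗ[C] C) (v : Fin (k + 2) → E) :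
    S.d τ v = ∑ i : Fin (k + 2), (-1 : C) ^ (i : ℕ) * S.act (v i) (τ (i.removeNth v)) -
      ∑ i : Fin (k + 1), ∑ j ≥ i, (-1 : C) ^ (i + j : ℕ) *
        τ (Matrix.vecCons (S.bracket (v i.castSucc) (v j.succ))
          (j.removeNth (i.castSucc.removeNth v))) := by
  have h2 : ∑ i : Fin (k + 2), (-1 : C) ^ (i : ℕ) *
        ∑ l, τ (Function.update (i.removeNth v) l (S.bracket (v i) (i.removeNth v l))) =
      2 * ∑ i : Fin (k + 1), ∑ j ≥ i, (-1 : C) ^ (i + j : ℕ) *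
        τ (Matrix.vecCons (S.bracket (v i.castSucc) (v j.succ))
          (j.removeNth (i.castSucc.removeNth v))) := by
    simp only [Finset.mul_sum]
    rw [Fin.sum_sum_eq_sum_triangle_add]
    refine Fintype.sum_congr _ _ fun i ↦ Finset.sum_congr rfl fun j hj ↦ ?_
    rw [Finset.mem_Ici] at hj
    have H₁ : i.castSucc.removeNth v j = v j.succ := by
      simp [Fin.removeNth_apply, Fin.succAbove_of_le_castSucc, hj]
    have H₂ : j.succ.removeNth v i = v i.castSucc := by
      simp [Fin.removeNth_apply, Fin.succAbove_of_castSucc_lt, hj]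
    have e : ∀ (u : Fin (k + 1) → E) (l : Fin (k + 1)) (y : E),
        τ (Function.update u l y) = (-1 : C) ^ (l : ℕ) *
          τ (Matrix.vecCons y (l.removeNth u)) := by
      intro u l y
      rw [← Fin.insertNth_removeNth, AlternatingMap.map_insertNth]
      simp
    rw [e, e, H₁, H₂, S.bracket_swap (v j.succ) (v i.castSucc)]
    have hneg : τ (Matrix.vecCons (-S.bracket (v i.castSucc) (v j.succ))
          (i.removeNth (j.succ.removeNth v))) =
        -τ (Matrix.vecCons (S.bracket (v i.castSucc) (v j.succ))
          (i.removeNth (j.succ.removeNth v))) := by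
      simpa using τ.map_vecCons_smul (i.removeNth (j.succ.removeNth v)) (-1)
        (S.bracket (v i.castSucc) (v j.succ))
    have hrr : i.removeNth (j.succ.removeNth v) = j.removeNth (i.castSucc.removeNth v) := by
      rw [Fin.removeNth_removeNth_eq_swap]
      simp [Fin.predAbove, hj, Fin.succAbove]
    rw [hneg, hrr]
    simp only [Fin.val_castSucc, Fin.val_succ, pow_add, pow_one]
    ring
  have h3 : S.d τ v = (1 / 2 : ℝ) •
      (2 * (∑ i : Fin (k + 2), (-1 : C) ^ (i : ℕ) * S.act (v i) (τ (i.removeNth v)) -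
        ∑ i : Fin (k + 1), ∑ j ≥ i, (-1 : C) ^ (i + j : ℕ) *
          τ (Matrix.vecCons (S.bracket (v i.castSucc) (v j.succ))
            (j.removeNth (i.castSucc.removeNth v))))) := by
    rw [mul_sub, ← h2, Finset.mul_sum, ← Finset.sum_sub_distrib]
    rw [d_eq]
    congr 1
    refine Finset.sum_congr rfl fun i _ => ?_
    rw [lieForm_apply]
    ring
  have h4 : ∀ T : C, (1 / 2 : ℝ) • (2 * T) = T := fun T => by
    rw [show (2 : C) * T = (2 : ℝ) • T by rw [Algebra.smul_def, map_ofNat], smul_smul]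
    norm_num
  rw [h3, h4]

end SkewAlgebroid

/-! ### Contractions -/

/-- The linear map on bivectors with `X ∧ Y ↦ B X Y`, for an alternating bilinear `B`. -/
def liftTwo (B : E →ₗ[C] E →ₗ[C] N) (hB : ∀ X, B X X = 0) : ⋀[C]^2 E →ₗ[C] N :=
  exteriorPower.alternatingMapLinearEquiv
    { toFun := fun v => B (v 0) (v 1)
      map_update_add' := by
        intro _ v i x y
        fin_cases i <;> simp
      map_update_smul' := by
        intro _ v i c x
        fin_cases i <;> simp
      map_eq_zero_of_eq' := by
        intro v i j hv hij
        fin_cases i <;> fin_cases j <;> simp_all }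

theorem liftTwo_ιMulti (B : E →ₗ[C] E →ₗ[C] N) (hB : ∀ X, B X X = 0) (X Y : E) :
    liftTwo B hB (exteriorPower.ιMulti C 2 ![X, Y]) = B X Y := by
  simp [liftTwo]

/-- `P^♯ : E* → E`, with `(X ∧ Y)^♯ α = α(X) Y - α(Y) X`, so `⟨β, P^♯ α⟩ = P(α, β)`. -/
def sharp : ⋀[C]^2 E →ₗ[C] Module.Dual C E →ₗ[C] E :=
  liftTwo
    (LinearMap.mk₂ C
      (fun X Y => (Module.Dual.eval C E X).smulRight Y - (Module.Dual.eval C E Y).smulRight X)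
      (by intros; ext; simp; module) (by intros; ext; simp; module)
      (by intros; ext; simp; module) (by intros; ext; simp; module))
    (by simp)

theorem sharp_ιMulti (X Y : E) (α : Module.Dual C E) :
    sharp (exteriorPower.ιMulti C 2 ![X, Y]) α = α X • Y - α Y • X := by
  rw [sharp, liftTwo_ιMulti]
  simp

theorem apply_sharp (P : ⋀[C]^2 E) (α β : Module.Dual C E) :
    β (sharp P α) = -α (sharp P β) := by
  have : (β ∘ₗ (LinearMap.applyₗ α)) ∘ₗ (sharp (C := C) (E := E)) =
      -((α ∘ₗ (LinearMap.applyₗ β)) ∘ₗ (sharp (C := C) (E := E))) := by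
    refine exteriorPower.linearMap_ext ?_
    ext v
    have hv : v = ![v 0, v 1] := by ext i; fin_cases i <;> rfl
    rw [hv]
    simp [sharp_ιMulti]
    ring
  exact congrArg (fun g => g P) this

/-- The interior product with a bivector, with `i_{X ∧ Y} = i_X ∘ i_Y`. -/
def interiorTwo (P : ⋀[C]^2 E) {k : ℕ} (τ : E [⋀^Fin (k + 2)]→ₗ[C] C) : E [⋀^Fin k]→ₗ[C] C :=
  liftTwo
    (LinearMap.mk₂ C (fun X Y => (τ.curryLeft Y).curryLeft X)
      (by intros; simp) (by intros; simp) (by intros; simp) (by intros; simp))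
    (by simp) P

/-- `α ∧ τ` for a one-form `α`: `(α ∧ τ)(X₀, …) = ∑ i, (-1)^i α(X_i) τ(…, omit X_i, …)`. -/
def wedgeOne (α : Module.Dual C E) {k : ℕ} (τ : E [⋀^Fin k]→ₗ[C] C) :
    E [⋀^Fin (k + 1)]→ₗ[C] C :=
  AlternatingMap.alternatizeUncurryFin (α.smulRight τ)

/-! ### First-order operators on exterior powers

An operator `T` which is not `C`-linear but satisfies `T (f a) = f T a + σ f a` is the second
component of a `C`-linear map `a ↦ (a, T a)` into `N₁ × N₂` with the scalar multiplication
`f (a, b) = (f a, f b + σ f a)`. This is used to define operators on exterior powers by their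
values on decomposable elements. -/

/-- The symbol `σ` of a first-order operator. -/
structure Symbol (C N₁ N₂ : Type*) [CommRing C] [AddCommGroup N₁] [Module C N₁]
    [AddCommGroup N₂] [Module C N₂] where
  toFun : C → N₁ → N₂
  map_add_left : ∀ (f g : C) (a : N₁), toFun (f + g) a = toFun f a + toFun g a
  map_add_right : ∀ (f : C) (a b : N₁), toFun f (a + b) = toFun f a + toFun f b
  map_smul_right : ∀ (f g : C) (a : N₁), toFun f (g • a) = g • toFun f a
  map_mul : ∀ (f g : C) (a : N₁), toFun (f * g) a = f • toFun g a + g • toFun f a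

variable {N₁ N₂ : Type*} [AddCommGroup N₁] [Module C N₁] [AddCommGroup N₂] [Module C N₂]

/-- `N₁ × N₂` with the twisted scalar multiplication `f (a, b) = (f a, f b + σ f a)`. -/
def Jet (_σ : Symbol C N₁ N₂) : Type _ := N₁ × N₂

instance jetAddCommGroup (σ : Symbol C N₁ N₂) : AddCommGroup (Jet σ) :=
  inferInstanceAs (AddCommGroup (N₁ × N₂))

theorem Symbol.map_one (σ : Symbol C N₁ N₂) (a : N₁) : σ.toFun 1 a = 0 := by
  have h := σ.map_mul 1 1 a
  simpa using h

theorem Symbol.map_zero_left (σ : Symbol C N₁ N₂) (a : N₁) : σ.toFun 0 a = 0 := by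
  have h := σ.map_add_left 0 0 a
  simpa using h

theorem Symbol.map_zero_right (σ : Symbol C N₁ N₂) (f : C) : σ.toFun f 0 = 0 := by
  have h := σ.map_add_right f 0 0
  simpa using h

instance jetModule (σ : Symbol C N₁ N₂) : Module C (Jet σ) where
  smul f a := (f • a.1, f • a.2 + σ.toFun f a.1)
  one_smul a := Prod.ext (one_smul _ _) (by
    change (1 : C) • a.2 + σ.toFun 1 a.1 = a.2
    rw [σ.map_one, one_smul, add_zero])
  mul_smul f g a := Prod.ext (mul_smul _ _ _) (by
    change (f * g) • a.2 + σ.toFun (f * g) a.1 =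
      f • (g • a.2 + σ.toFun g a.1) + σ.toFun f (g • a.1)
    rw [σ.map_mul, σ.map_smul_right, mul_smul, smul_add]
    abel)
  smul_zero f := Prod.ext (smul_zero _) (by
    change f • (0 : N₂) + σ.toFun f 0 = 0
    rw [σ.map_zero_right, smul_zero, add_zero])
  smul_add f a b := Prod.ext (smul_add _ _ _) (by
    change f • (a.2 + b.2) + σ.toFun f (a.1 + b.1) =
      (f • a.2 + σ.toFun f a.1) + (f • b.2 + σ.toFun f b.1)
    rw [σ.map_add_right, smul_add]
    abel)
  add_smul f g a := Prod.ext (add_smul _ _ _) (by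
    change (f + g) • a.2 + σ.toFun (f + g) a.1 =
      (f • a.2 + σ.toFun f a.1) + (g • a.2 + σ.toFun g a.1)
    rw [σ.map_add_left, add_smul]
    abel)
  zero_smul a := Prod.ext (zero_smul _ _) (by
    change (0 : C) • a.2 + σ.toFun 0 a.1 = 0
    rw [σ.map_zero_left, zero_smul, add_zero])

/-- The pair `(a, b)`. -/
def Jet.mk (σ : Symbol C N₁ N₂) (a : N₁) (b : N₂) : Jet σ := (a, b)

theorem Jet.mk_add_mk (σ : Symbol C N₁ N₂) (a a' : N₁) (b b' : N₂) :
    Jet.mk σ a b + Jet.mk σ a' b' = Jet.mk σ (a + a') (b + b') := rfl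

theorem Jet.smul_mk (σ : Symbol C N₁ N₂) (f : C) (a : N₁) (b : N₂) :
    f • Jet.mk σ a b = Jet.mk σ (f • a) (f • b + σ.toFun f a) := rfl

namespace SkewAlgebroid

variable (S : SkewAlgebroid C E)

/-- The symbol of `L_X` on multivectors. -/
def lieSymbol (X : E) (k : ℕ) : Symbol C (⋀[C]^k E) (⋀[C]^k E) where
  toFun f a := S.act X f • a
  map_add_left f g a := by simp [add_smul]
  map_add_right f a b := by simp
  map_smul_right f g a := smul_comm _ _ _
  map_mul f g a := by simp [add_smul, mul_smul]

/-- `(X₁, …, X_k) ↦ (X₁ ∧ … ∧ X_k, ∑ i, X₁ ∧ … ∧ [X, X_i] ∧ … ∧ X_k)`. -/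
def lieJet (X : E) (k : ℕ) : E [⋀^Fin k]→ₗ[C] Jet (S.lieSymbol X k) where
  toFun v := Jet.mk _ (exteriorPower.ιMulti C k v)
    (slotSum (exteriorPower.ιMulti C k) (S.bracket X) v)
  map_update_add' v j x y := by
    have : ‹DecidableEq (Fin k)› = instDecidableEqFin k := Subsingleton.elim _ _
    subst this
    rw [slotSum_update_add _ (S.bracket_add_right X), AlternatingMap.map_update_add,
      Jet.mk_add_mk]
  map_update_smul' v j f x := by
    have : ‹DecidableEq (Fin k)› = instDecidableEqFin k := Subsingleton.elim _ _
    subst this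
    rw [slotSum_update_smul _ (S.bracket_smul X), AlternatingMap.map_update_smul, Jet.smul_mk]
    rfl
  map_eq_zero_of_eq' v i j hv hij := by
    rw [slotSum_eq_zero _ _ _ hv hij, AlternatingMap.map_eq_zero_of_eq _ _ hv hij]
    rfl

/-- The Lie derivative `L_X η = [X, η]` of a multivector: the additive operator with
`L_X (X₁ ∧ … ∧ X_k) = ∑ i, X₁ ∧ … ∧ [X, X_i] ∧ … ∧ X_k` and `L_X (f η) = f L_X η + (ρ(X) f) η`
(`lie_ιMulti`, `lie_add`, `lie_smul`). -/
def lie (X : E) {k : ℕ} (η : ⋀[C]^k E) : ⋀[C]^k E :=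
  (exteriorPower.alternatingMapLinearEquiv (S.lieJet X k) η).2

theorem lie_ιMulti (X : E) {k : ℕ} (v : Fin k → E) :
    S.lie X (exteriorPower.ιMulti C k v) =
      ∑ i, exteriorPower.ιMulti C k (Function.update v i (S.bracket X (v i))) := by
  unfold lie
  rw [exteriorPower.alternatingMapLinearEquiv_apply_ιMulti]
  rfl

theorem lie_add (X : E) {k : ℕ} (η ζ : ⋀[C]^k E) : S.lie X (η + ζ) = S.lie X η + S.lie X ζ := by
  unfold lie
  rw [map_add]
  rfl

theorem lieJet_fst (X : E) {k : ℕ} (η : ⋀[C]^k E) :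
    (exteriorPower.alternatingMapLinearEquiv (S.lieJet X k) η).1 = η := by
  let p : Jet (S.lieSymbol X k) →ₗ[C] ⋀[C]^k E :=
    { toFun := fun a => a.1, map_add' := fun _ _ => rfl, map_smul' := fun _ _ => rfl }
  have : p ∘ₗ exteriorPower.alternatingMapLinearEquiv (S.lieJet X k) = LinearMap.id := by
    refine exteriorPower.linearMap_ext ?_
    ext v : 1
    simp only [LinearMap.compAlternatingMap_apply, LinearMap.comp_apply,
      exteriorPower.alternatingMapLinearEquiv_apply_ιMulti]
    rfl
  exact congrArg (fun g => g η) this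

theorem lie_smul (X : E) (f : C) {k : ℕ} (η : ⋀[C]^k E) :
    S.lie X (f • η) = f • S.lie X η + S.act X f • η := by
  conv_rhs => rw [← S.lieJet_fst X η]
  rw [S.lieJet_fst X η]
  unfold lie
  rw [map_smul]
  change f • _ + S.act X f • (exteriorPower.alternatingMapLinearEquiv (S.lieJet X k) η).1 = _
  rw [S.lieJet_fst]

theorem multivector_induction {k : ℕ} {p : ⋀[C]^k E → Prop}
    (h0 : ∀ v, p (exteriorPower.ιMulti C k v))
    (hadd : ∀ a b, p a → p b → p (a + b)) (hsmul : ∀ (f : C) a, p a → p (f • a))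
    (η : ⋀[C]^k E) : p η := by
  have h : η ∈ Submodule.span C (Set.range (exteriorPower.ιMulti C k (M := E))) := by
    rw [exteriorPower.ιMulti_span]; trivial
  induction h using Submodule.span_induction with
  | mem x hx => obtain ⟨v, rfl⟩ := hx; exact h0 v
  | zero =>
    have := hsmul 0 _ (h0 fun _ => 0)
    rwa [zero_smul] at this
  | add a b _ _ ha hb => exact hadd a b ha hb
  | smul f a _ ha => exact hsmul f a ha

/-! ### The Schouten bracket of bivectors

The sign convention is `[P, Q ∧ R] = [P, Q] ∧ R + (-1)^((p-1)q) Q ∧ [P, R]`,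
`[P, Q] = -(-1)^((p-1)(q-1)) [Q, P]`. For a bivector `P` this gives `[P, f] = -P^♯ df`,
`[P, X] = -L_X P` and `[P, X ∧ Y] = [P, X] ∧ Y - X ∧ [P, Y]`. -/

theorem coe_ιMulti_two (v : Fin 2 → E) :
    ((exteriorPower.ιMulti C 2 v : ⋀[C]^2 E) : ExteriorAlgebra C E) =
      ExteriorAlgebra.ι C (v 0) * ExteriorAlgebra.ι C (v 1) := by
  rw [exteriorPower.ιMulti_apply_coe, ExteriorAlgebra.ιMulti_apply]
  simp [List.ofFn_succ]

theorem ι_swap (X Y : E) : ExteriorAlgebra.ι C X * ExteriorAlgebra.ι C Y =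
    -(ExteriorAlgebra.ι C Y * ExteriorAlgebra.ι C X) :=
  eq_neg_of_add_eq_zero_left (ExteriorAlgebra.ι_add_mul_swap X Y)

theorem bivector_commute (P : ⋀[C]^2 E) (X : E) :
    (P : ExteriorAlgebra C E) * ExteriorAlgebra.ι C X =
      ExteriorAlgebra.ι C X * (P : ExteriorAlgebra C E) := by
  induction P using multivector_induction with
  | h0 v =>
    rw [coe_ιMulti_two, mul_assoc, ι_swap (v 1) X, mul_neg, ← mul_assoc, ι_swap (v 0) X,
      neg_mul, neg_neg, mul_assoc]
  | hadd a b ha hb => simp [add_mul, mul_add, ha, hb]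
  | hsmul f a ha => simp [ha]

theorem lie_smul_left_bivector (f : C) (X : E) (P : ⋀[C]^2 E) :
    (S.lie (f • X) P : ExteriorAlgebra C E) = f • (S.lie X P : ExteriorAlgebra C E) -
      ExteriorAlgebra.ι C X * ExteriorAlgebra.ι C (sharp P (S.dFun f)) := by
  induction P using multivector_induction with
  | h0 v =>
    have hv : v = ![v 0, v 1] := by ext i; fin_cases i <;> rfl
    rw [hv, lie_ιMulti, lie_ιMulti, sharp_ιMulti]
    simp only [Fin.sum_univ_two, Submodule.coe_add, coe_ιMulti_two, bracket_smul_left]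
    simp [dFun, sub_mul, mul_sub, smul_sub]
    rw [ι_swap (v 0) X]
    simp
    abel
  | hadd a b ha hb =>
    rw [lie_add, lie_add, map_add, LinearMap.add_apply, map_add, mul_add, Submodule.coe_add, ha,
      hb, Submodule.coe_add, smul_add]
    abel
  | hsmul g a ha =>
    rw [lie_smul, lie_smul, (sharp (C := C) (E := E)).map_smul, LinearMap.smul_apply,
      (ExteriorAlgebra.ι C).map_smul, mul_smul_comm, Submodule.coe_add, Submodule.coe_smul, ha, Submodule.coe_add, Submodule.coe_smul,
      Submodule.coe_smul, map_smul]
    simp only [Derivation.coe_smul, Pi.smul_apply, smul_eq_mul, smul_sub, smul_add, mul_smul,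
      Submodule.coe_smul]
    rw [smul_comm g f]
    abel

/-- `f, a ↦ [P, f] ∧ a` with `[P, f] = -P^♯ df`. -/
def schoutenSymbol (P : ⋀[C]^2 E) : Symbol C (ExteriorAlgebra C E) (ExteriorAlgebra C E) where
  toFun f a := -(ExteriorAlgebra.ι C (sharp P (S.dFun f)) * a)
  map_add_left f g a := by
    have : S.dFun (f + g) = S.dFun f + S.dFun g := by ext; simp [dFun]
    rw [this, map_add, map_add, add_mul, neg_add]
  map_add_right f a b := by rw [mul_add, neg_add]
  map_smul_right f g a := by rw [mul_smul_comm, smul_neg]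
  map_mul f g a := by
    have : S.dFun (f * g) = f • S.dFun g + g • S.dFun f := by ext; simp [dFun]
    rw [this, map_add, map_smul, map_smul, map_add, map_smul, map_smul, add_mul, smul_mul_assoc,
      smul_mul_assoc, neg_add, smul_neg, smul_neg]

/-- `[P, X] = -L_X P`. -/
def schoutenVector (P : ⋀[C]^2 E) (X : E) : ExteriorAlgebra C E :=
  -(S.lie X P : ExteriorAlgebra C E)

theorem lie_add_left_bivector (X Y : E) (P : ⋀[C]^2 E) :
    S.lie (X + Y) P = S.lie X P + S.lie Y P := by
  induction P using multivector_induction with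
  | h0 v =>
    simp [lie_ιMulti, S.bracket_add_left, AlternatingMap.map_update_add, Finset.sum_add_distrib]
  | hadd a b ha hb =>
    rw [lie_add, lie_add, lie_add, ha, hb]
    abel
  | hsmul g a ha =>
    rw [lie_smul, lie_smul, lie_smul, ha, map_add, Derivation.add_apply, add_smul, smul_add]
    abel

theorem schoutenVector_add (P : ⋀[C]^2 E) (X Y : E) :
    S.schoutenVector P (X + Y) = S.schoutenVector P X + S.schoutenVector P Y := by
  unfold schoutenVector
  rw [lie_add_left_bivector, Submodule.coe_add, neg_add]

theorem schoutenVector_smul (P : ⋀[C]^2 E) (f : C) (X : E) :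
    S.schoutenVector P (f • X) = f • S.schoutenVector P X +
      (S.schoutenSymbol P).toFun f (ExteriorAlgebra.ι C X) := by
  unfold schoutenVector schoutenSymbol
  rw [lie_smul_left_bivector, ι_swap X]
  simp [add_comm]

theorem schoutenVector_commute (P : ⋀[C]^2 E) (X Y : E) :
    S.schoutenVector P X * ExteriorAlgebra.ι C Y =
      ExteriorAlgebra.ι C Y * S.schoutenVector P X := by
  unfold schoutenVector
  rw [neg_mul, mul_neg, bivector_commute]

/-- `X ∧ Y ↦ (X ∧ Y, [P, X] ∧ Y - X ∧ [P, Y])`. -/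
def schoutenJet (P : ⋀[C]^2 E) : ⋀[C]^2 E →ₗ[C] Jet (S.schoutenSymbol P) :=
  liftTwo
    (LinearMap.mk₂ C
      (fun X Y => Jet.mk _ (ExteriorAlgebra.ι C X * ExteriorAlgebra.ι C Y)
        (S.schoutenVector P X * ExteriorAlgebra.ι C Y -
          ExteriorAlgebra.ι C X * S.schoutenVector P Y))
      (by
        intro X X' Y
        rw [Jet.mk_add_mk]
        congr 1
        · rw [map_add, add_mul]
        · rw [schoutenVector_add, map_add, add_mul, add_mul]; abel)
      (by
        intro f X Y
        rw [Jet.smul_mk]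
        congr 1
        · rw [map_smul, smul_mul_assoc]
        · rw [schoutenVector_smul, map_smul]
          simp [schoutenSymbol, add_mul, smul_sub, mul_assoc]
          abel)
      (by
        intro X Y Y'
        rw [Jet.mk_add_mk]
        congr 1
        · rw [map_add, mul_add]
        · rw [schoutenVector_add, map_add, mul_add, mul_add]; abel)
      (by
        intro f X Y
        rw [Jet.smul_mk]
        congr 1
        · rw [map_smul, mul_smul_comm]
        · rw [schoutenVector_smul, map_smul]
          simp [schoutenSymbol, mul_add, smul_sub, ← mul_assoc]
          rw [ι_swap X]
          simp
          abel))
    (by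
      intro X
      simp only [LinearMap.mk₂_apply]
      rw [schoutenVector_commute, sub_self, ExteriorAlgebra.ι_sq_zero]
      rfl)

/-- The Schouten bracket `[P, Q]` of bivectors, with values in the exterior algebra. -/
def schouten (P Q : ⋀[C]^2 E) : ExteriorAlgebra C E := (S.schoutenJet P Q).2

theorem schouten_ιMulti (P : ⋀[C]^2 E) (X Y : E) :
    S.schouten P (exteriorPower.ιMulti C 2 ![X, Y]) =
      -(S.lie X P : ExteriorAlgebra C E) * ExteriorAlgebra.ι C Y +
        ExteriorAlgebra.ι C X * (S.lie Y P : ExteriorAlgebra C E) := by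
  unfold schouten schoutenJet
  rw [liftTwo_ιMulti]
  change S.schoutenVector P X * _ - _ * S.schoutenVector P Y = _
  simp [schoutenVector]

/-- The Schouten-Jacobi bracket of bivectors, `[P, Q]^φ = [P, Q] + P ∧ i_φ Q + i_φ P ∧ Q`, where
`i_φ P = P^♯ φ`. -/
def schoutenJacobi (φ : Module.Dual C E) (P Q : ⋀[C]^2 E) : ExteriorAlgebra C E :=
  S.schouten P Q + (P : ExteriorAlgebra C E) * ExteriorAlgebra.ι C (sharp Q φ) +
    ExteriorAlgebra.ι C (sharp P φ) * (Q : ExteriorAlgebra C E)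

/-- `P` is a Poisson bivector: `[P, P] = 0`. -/
def IsPoisson (P : ⋀[C]^2 E) : Prop := S.schouten P P = 0

/-- `P` is a Jacobi bivector: `[P, P]^φ = 0`. -/
def IsJacobi (φ : Module.Dual C E) (P : ⋀[C]^2 E) : Prop := S.schoutenJacobi φ P P = 0

/-- `dφ = 0`. -/
def IsCocycle (φ : Module.Dual C E) : Prop :=
  S.d (AlternatingMap.ofSubsingleton C E C (0 : Fin 1) φ) = 0

/-! ### The structure induced on the dual -/

/-- `d^φ f = df + f φ`. -/
def dFunTwisted (φ : Module.Dual C E) (f : C) : Module.Dual C E := S.dFun f + f • φ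

/-- `L^φ_X β = i_X d^φ β + d^φ i_X β = L_X β + φ(X) β`, with `d^φ = d + φ ∧ ·`. -/
def lieOneTwisted (φ : Module.Dual C E) (X : E) (β : Module.Dual C E) : Module.Dual C E :=
  S.lieOne X β + φ X • β

/-- The structure on `E*` induced by a bivector `P`: the anchor is `ρ ∘ P^♯` and
`[α, β]_P = L^φ_{P^♯ α} β - L^φ_{P^♯ β} α - d^φ (P(α, β))`. -/
def dualAlgebroid (φ : Module.Dual C E) (P : ⋀[C]^2 E) : SkewAlgebroid C (Module.Dual C E) where
  bracket α β := S.lieOneTwisted φ (sharp P α) β - S.lieOneTwisted φ (sharp P β) α -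
    S.dFunTwisted φ (β (sharp P α))
  act := S.act ∘ₗ sharp P
  bracket_add_right α β γ := by
    ext X
    simp [lieOneTwisted, lieOne, dFunTwisted, dFun, S.bracket_add_left]
    ring
  bracket_add_left α β γ := by
    ext X
    simp [lieOneTwisted, lieOne, dFunTwisted, dFun, S.bracket_add_left]
    ring
  bracket_self α := by
    have h : α (sharp P α) = 0 := by
      have h1 := apply_sharp P α α
      have h2 : (2 : ℝ) • α (sharp P α) = 0 := by
        rw [two_smul]; nth_rewrite 1 [h1]; simp
      simpa using congrArg (fun c => (1 / 2 : ℝ) • c) h2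
    ext X
    simp [h, dFunTwisted, dFun]
  bracket_smul α f β := by
    ext X
    have h := apply_sharp P α β
    simp [lieOneTwisted, lieOne, dFunTwisted, dFun, S.bracket_smul_left, h]
    ring

/-- `α ∧ d (i_P τ)`; here `i_P τ = 0` if `τ` has degree `0` or `1`. -/
def wedgeDInterior (α : Module.Dual C E) (P : ⋀[C]^2 E) :
    {k : ℕ} → (E [⋀^Fin k]→ₗ[C] C) → (E [⋀^Fin k]→ₗ[C] C)
  | 0, _ => 0
  | 1, _ => 0
  | _ + 2, τ => wedgeOne α (S.d (interiorTwo P τ))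

/-- The structure on `E*` induced by a Poisson bivector (the case `φ = 0`). -/
def poissonDual (P : ⋀[C]^2 E) : SkewAlgebroid C (Module.Dual C E) := S.dualAlgebroid 0 P

end SkewAlgebroid

/-- The form on `E` given by a multivector of `E*`:
`(α₁ ∧ … ∧ α_k)(X₁, …, X_k) = det (α_i(X_j))`. -/
def toForm {k : ℕ} (ν : ⋀[C]^k (Module.Dual C E)) : E [⋀^Fin k]→ₗ[C] C :=
  exteriorPower.alternatingMapLinearEquiv.symm (exteriorPower.pairingDual C E k ν)

/-- The pairing of a form with a multivector, `⟨τ, X₁ ∧ … ∧ X_k⟩ = τ(X₁, …, X_k)`. -/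
def pairing {k : ℕ} (τ : E [⋀^Fin k]→ₗ[C] C) (η : ⋀[C]^k E) : C :=
  exteriorPower.alternatingMapLinearEquiv τ η

end Algebra

section Manifold

/-! ## Lie algebroids over a manifold -/

variable (m : ℕ) (M : Type*) [TopologicalSpace M] [ChartedSpace (EuclideanSpace ℝ (Fin m)) M]

/-- `C^∞(M)`. -/
abbrev SmoothFun : Type _ := C^∞⟮𝓡 m, M; ℝ⟯

/-- Smooth vector fields on `M`. -/
abbrev VectorField [IsManifold (𝓡 m) ∞ M] : Type _ :=
  Cₛ^∞⟮𝓡 m; EuclideanSpace ℝ (Fin m), (TangentSpace (𝓡 m) : M → Type)⟯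

variable {m M}
variable {F : Type*} [NormedAddCommGroup F] [NormedSpace ℝ F]
  {V : M → Type*} [TopologicalSpace (TotalSpace F V)]
  [∀ x, AddCommGroup (V x)] [∀ x, Module ℝ (V x)] [∀ x, TopologicalSpace (V x)]
  [FiberBundle F V] [VectorBundle ℝ F V]

/-- The smooth sections of a vector bundle form a module over `C^∞(M)`. -/
instance sectionModule : Module (SmoothFun m M) Cₛ^∞⟮𝓡 m; F, V⟯ where
  smul f s := ⟨fun x => f x • s x, f.contMDiff.smul_section s.contMDiff⟩
  one_smul s := by ext x; exact one_smul ℝ (s x)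
  mul_smul f g s := by ext x; exact mul_smul (f x) (g x) (s x)
  smul_zero f := by ext x; exact smul_zero (f x)
  smul_add f s t := by ext x; exact smul_add (f x) (s x) (t x)
  add_smul f g s := by ext x; exact add_smul (f x) (g x) (s x)
  zero_smul s := by ext x; exact zero_smul ℝ (s x)

theorem smul_section_apply (f : SmoothFun m M) (s : Cₛ^∞⟮𝓡 m; F, V⟯) (x : M) :
    (f • s) x = f x • s x := rfl

variable [IsManifold (𝓡 m) ∞ M]

variable (m M) in
theorem isManifold_min_two : IsManifold (𝓡 m) (minSmoothness ℝ 2) M := by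
  rw [minSmoothness_of_isRCLikeNormedField]
  infer_instance

variable (m M) in
theorem isManifold_min_three : IsManifold (𝓡 m) (minSmoothness ℝ 3) M := by
  rw [minSmoothness_of_isRCLikeNormedField]
  infer_instance

theorem contMDiff_deriv (X : VectorField m M) (f : SmoothFun m M) :
    ContMDiff (𝓡 m) 𝓘(ℝ, ℝ) ∞ (fun x => mvfderiv (𝓡 m) f x (X x)) := by
  have h1 : ContMDiff (𝓡 m).tangent 𝓘(ℝ, ℝ).tangent ∞ (tangentMap (𝓡 m) 𝓘(ℝ, ℝ) f) :=
    f.contMDiff.contMDiff_tangentMap (by simp)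
  have h2 := h1.comp X.contMDiff
  exact (contMDiff_snd_tangentBundle_modelSpace ℝ 𝓘(ℝ, ℝ)).comp h2

theorem mdiffAt_fun (f : SmoothFun m M) (x : M) : MDifferentiableAt (𝓡 m) 𝓘(ℝ, ℝ) f x :=
  (f.contMDiff x).mdifferentiableAt (by simp)

/-- The derivation `f ↦ X f = df(X)` of `C^∞(M)` given by a vector field. -/
def VectorField.deriv : VectorField m M →ₗ[SmoothFun m M]
    Derivation ℝ (SmoothFun m M) (SmoothFun m M) where
  toFun X := Derivation.mk'
    { toFun := fun f => ⟨fun x => mvfderiv (𝓡 m) f x (X x), contMDiff_deriv X f⟩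
      map_add' := by
        intro f g
        ext x
        change mvfderiv (𝓡 m) (⇑f + ⇑g) x (X x) = _
        rw [mvfderiv_add (mdiffAt_fun f x) (mdiffAt_fun g x)]
        rfl
      map_smul' := by
        intro c f
        ext x
        change mvfderiv (𝓡 m) ((fun _ : M => c) • ⇑f) x (X x) = _
        rw [mvfderiv_smul (mdifferentiableAt_const) (mdiffAt_fun f x), mvfderiv_const]
        simp
        rfl }
    (by
      intro f g
      ext x
      change mvfderiv (𝓡 m) (⇑f * ⇑g) x (X x) = _
      rw [mvfderiv_mul (mdiffAt_fun f x) (mdiffAt_fun g x)]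
      rfl)
  map_add' X Y := by
    ext f x
    exact (mvfderiv (𝓡 m) f x).map_add (X x) (Y x)
  map_smul' g X := by
    ext f x
    exact (mvfderiv (𝓡 m) f x).map_smul (g x) (X x)

theorem VectorField.deriv_apply (X : VectorField m M) (f : SmoothFun m M) (x : M) :
    VectorField.deriv X f x = mvfderiv (𝓡 m) f x (X x) := rfl

variable (m M) in
/-- The tangent bundle: the Lie bracket of vector fields, with the identity as anchor. -/
def tangentAlgebroid : SkewAlgebroid (SmoothFun m M) (VectorField m M) where
  bracket X Y := ⟨VectorField.mlieBracket (𝓡 m) X Y, by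
    have := isManifold_min_two m M
    have := isManifold_min_three m M
    have : IsManifold (𝓡 m) (((⊤ : ℕ∞) : ℕ∞ω) + 1) M := inferInstanceAs (IsManifold (𝓡 m) ∞ M)
    exact ContDiff.mlieBracket_vectorField (m := ⊤) (n := ⊤) X.contMDiff Y.contMDiff (by simp)⟩
  act := VectorField.deriv
  bracket_add_right X Y Z := by
    have := isManifold_min_two m M
    ext x : 1
    exact VectorField.mlieBracket_add_right Y.mdifferentiableAt Z.mdifferentiableAt
  bracket_add_left X Y Z := by
    have := isManifold_min_two m M
    ext x : 1
    exact VectorField.mlieBracket_add_left X.mdifferentiableAt Y.mdifferentiableAt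
  bracket_self X := by
    ext x : 1
    change VectorField.mlieBracket (𝓡 m) X X x = 0
    rw [VectorField.mlieBracket_self]
    rfl
  bracket_smul X f Y := by
    have := isManifold_min_two m M
    ext x : 1
    refine (VectorField.mlieBracket_smul_right (mdiffAt_fun f x) Y.mdifferentiableAt).trans ?_
    exact add_comm _ _

variable (m F V) in
/-- A Lie algebroid structure on the vector bundle `V` over `M`: a Lie bracket on the sections and
an anchor `V → TM` (given by its `C^∞(M)`-linear action on sections) subject to the Leibniz
rule. -/
structure LieAlgebroid where
  bracket : Cₛ^∞⟮𝓡 m; F, V⟯ → Cₛ^∞⟮𝓡 m; F, V⟯ → Cₛ^∞⟮𝓡 m; F, V⟯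
  anchor : Cₛ^∞⟮𝓡 m; F, V⟯ →ₗ[SmoothFun m M] VectorField m M
  bracket_add_right : ∀ X Y Z, bracket X (Y + Z) = bracket X Y + bracket X Z
  bracket_add_left : ∀ X Y Z, bracket (X + Y) Z = bracket X Z + bracket Y Z
  bracket_self : ∀ X, bracket X X = 0
  jacobi : ∀ X Y Z, bracket X (bracket Y Z) = bracket (bracket X Y) Z + bracket Y (bracket X Z)
  bracket_smul : ∀ X (f : SmoothFun m M) Y,
    bracket X (f • Y) = f • bracket X Y + VectorField.deriv (anchor X) f • Y
  anchor_bracket : ∀ X Y, anchor (bracket X Y) = (tangentAlgebroid m M).bracket (anchor X) (anchor Y)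


namespace LieAlgebroid

/-- The underlying bracket and action on functions. -/
def toSkew (A : LieAlgebroid m F V) : SkewAlgebroid (SmoothFun m M) Cₛ^∞⟮𝓡 m; F, V⟯ where
  bracket := A.bracket
  act := VectorField.deriv ∘ₗ A.anchor
  bracket_add_right := A.bracket_add_right
  bracket_add_left := A.bracket_add_left
  bracket_self := A.bracket_self
  bracket_smul := A.bracket_smul

end LieAlgebroid

/-- A nowhere vanishing form of top degree on `M`. -/
def IsVolumeForm (μ : VectorField m M [⋀^Fin m]→ₗ[SmoothFun m M] SmoothFun m M) : Prop :=
  ∀ x : M, ∃ X : Fin m → VectorField m M, μ X x ≠ 0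

/-- `ξ` is the modular form with respect to `η ⊗ μ` of an algebroid `S` with anchor `ρ` to `TM`:
`⟨ξ, X⟩ η ⊗ μ = L_X η ⊗ μ + η ⊗ L_{ρ(X)} μ` for all sections `X`. -/
def IsModularForm {E : Type*} [AddCommGroup E] [Module (SmoothFun m M) E]
    (S : SkewAlgebroid (SmoothFun m M) E) (ρ : E →ₗ[SmoothFun m M] VectorField m M) {n : ℕ}
    (η : ⋀[SmoothFun m M]^n E) (μ : VectorField m M [⋀^Fin m]→ₗ[SmoothFun m M] SmoothFun m M)
    (ξ : Module.Dual (SmoothFun m M) E) : Prop :=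
  ∀ X : E, ξ X • (η ⊗ₜ[SmoothFun m M] μ) =
    S.lie X η ⊗ₜ[SmoothFun m M] μ +
      η ⊗ₜ[SmoothFun m M] (tangentAlgebroid m M).lieForm (ρ X) μ

/-- The modular form of the Jacobi algebroid `(S, φ)` of rank `n`, namely `ξ - (n - 1) φ`, where `ξ`
is the modular form of `S`. -/
def jacobiModularForm {E : Type*} [AddCommGroup E] [Module (SmoothFun m M) E] (n : ℕ)
    (φ ξ : Module.Dual (SmoothFun m M) E) : Module.Dual (SmoothFun m M) E :=
  ξ - ((n : SmoothFun m M) - 1) • φ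

end Manifold
end LieAlgd
end

/-!
Write `τ` for the form of `ν`, `Y = P^♯ α`, and `div X` for the function with `L_X η = (div X) η`, so
that `L_X τ = -(div X) τ`. The value of a modular form on a section is the sum of two divergences,
`⟨ξ_A, X⟩ = div X + div_μ ρ(X)`. The anchor of the dual algebroid sends `α` to `ρ(Y)`, so the `μ`-terms
of `⟨ξ_{A*}, α⟩` and of `⟨ξ_A, Y⟩ = -⟨α, P^♯ ξ_A⟩` agree, and the theorem compares the divergence
of `α` in the dual algebroid with that of `Y`. It comes from two identities of top forms, valid for
every bivector `P`.

* `wedgeDInterior_of_top`: `α ∧ d i_P τ = -L_Y τ - dα(P) τ`. This is Cartan calculus for decomposable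
  `P`, where `dτ = 0` and `β ∧ i_X τ = β(X) τ` because forms of degree above the rank vanish.
* `toForm_lie_dualAlgebroid`: the operator `[α, ·]_P` on the dual and `D = [Y, ·] + T` on sections
  satisfy the Leibniz rule `ρ(Y)(β(X)) = [α, β]_P(X) + β(D X)`, where `T` is linear over functions,
  `T X = P^♯(i_X dα) - φ(Y) X - α(X) P^♯ φ + φ(X) Y`. The trace of
  `T` is `-2 dα(P) - (n - 2) φ(Y)`; hence `[α, ·]_P` acts on `τ` as `L_Y + 2 dα(P) + (n - 2) φ(Y)`.

Eliminating `dα(P)` gives `pairing_lie_dualAlgebroid`. The three formulas of the Jacobi case then differ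
by multiples of `⟨α, X₀⟩ = φ(Y)`.

Existence and uniqueness of modular forms rest on top exterior powers being free of rank one. The
geometric input is condensed into `HasLocalFrames`: sections admit local frames after multiplication
by bump functions. It passes to the dual module, makes forms above the rank vanish, and makes top forms
proportional (`form_mul_comm`). Since `⟨ν, η⟩ = 1`, expanding `η` into decomposables yields a finite
generalized dual basis of the sections (`exists_dual_basis`); thus exterior powers are projective, and
a top multivector is determined by its pairings with forms (`eq_pairing_smul`). This applies alike to
the sections and to their dual. For volume forms on `M`, which need not come with a dual multivector, the
quotient of two top forms is smooth because it locally is a quotient of smooth functions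
(`IsVolumeForm.exists_eq_smul`).
-/

namespace LieAlgd

section Algebra

variable {C : Type*} [CommRing C] [Algebra ℝ C]
variable {E : Type*} [AddCommGroup E] [Module C E]
variable {N : Type*} [AddCommGroup N] [Module C N]

/-! ### Modules with local frames -/

/-- The module `E` behaves like the sections of a vector bundle of rank `n`: a function `c` vanishes
as soon as it is killed by powers of all functions `f` that admit a "localized frame", that is,
elements `s i` of `E` and functionals `θ i` with `f X = ∑ i, θ i (X) s i`. For sections of a
bundle, `f`, `s` and `θ` arise from a local frame by multiplying with bump functions. -/
def HasLocalFrames (C E : Type*) [CommRing C] [AddCommGroup E] [Module C E] (n : ℕ) : Prop :=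
  ∀ c : C, (∀ (f : C) (s : Fin n → E) (θ : Fin n → Module.Dual C E),
    (∀ X, f • X = ∑ i, θ i X • s i) → ∃ N : ℕ, f ^ N * c = 0) → c = 0

theorem HasLocalFrames.dual {n : ℕ} (hE : HasLocalFrames C E n) :
    HasLocalFrames C (Module.Dual C E) n := by
  intro c hc
  refine hE c fun f s θ h => hc f θ (fun i => Module.Dual.eval C E (s i)) fun β => ?_
  ext X
  have := congrArg β (h X)
  simpa [mul_comm] using this

theorem pow_smul_map_of_frame {n k : ℕ} {f : C} {s : Fin n → E} {θ : Fin n → Module.Dual C E}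
    (h : ∀ X, f • X = ∑ i, θ i X • s i) (τ : E [⋀^Fin k]→ₗ[C] N) (v : Fin k → E) :
    f ^ k • τ v =
      τ.compLinearMap (Fintype.linearCombination C s) (fun j i => θ i (v j)) := by
  have h1 : τ (fun j => f • v j) = f ^ k • τ v := by
    have := τ.toMultilinearMap.map_smul_univ (fun _ => f) v
    simpa using this
  rw [← h1, AlternatingMap.compLinearMap_apply]
  congr 1
  ext j
  rw [h, Fintype.linearCombination_apply]

theorem HasLocalFrames.form_eq_zero {n k : ℕ} (hE : HasLocalFrames C E n) (hk : n < k)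
    (τ : E [⋀^Fin k]→ₗ[C] C) : τ = 0 := by
  ext v
  refine hE _ fun f s θ h => ⟨k, ?_⟩
  rw [← smul_eq_mul, pow_smul_map_of_frame h]
  have h0 : τ.compLinearMap (Fintype.linearCombination C s) = 0 := by
    refine Module.Basis.ext_alternating (Pi.basisFun C (Fin n)) fun w hw => ?_
    exact absurd (Fintype.card_le_of_injective w hw) (by simpa using hk)
  rw [h0, AlternatingMap.zero_apply]

/-- Forms of top degree are proportional: on a localized frame both are multiples of the
determinant. -/
theorem HasLocalFrames.form_mul_comm {n : ℕ} (hE : HasLocalFrames C E n)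
    (τ τ' : E [⋀^Fin n]→ₗ[C] C) (v w : Fin n → E) : τ v * τ' w = τ w * τ' v := by
  rw [← sub_eq_zero]
  refine hE _ fun f s θ h => ⟨n + n, ?_⟩
  have key : ∀ σ : E [⋀^Fin n]→ₗ[C] C, ∃ a : C, ∀ u : Fin n → E,
      f ^ n * σ u = a * (Pi.basisFun C (Fin n)).det (fun j i => θ i (u j)) := by
    intro σ
    refine ⟨σ.compLinearMap (Fintype.linearCombination C s) (Pi.basisFun C (Fin n)), fun u => ?_⟩
    rw [← smul_eq_mul, pow_smul_map_of_frame h,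
      (σ.compLinearMap (Fintype.linearCombination C s)).eq_smul_basis_det (Pi.basisFun C (Fin n)),
      AlternatingMap.smul_apply, smul_eq_mul, AlternatingMap.smul_apply, Module.Basis.det_self]
    simp
  obtain ⟨a, ha⟩ := key τ
  obtain ⟨b, hb⟩ := key τ'
  calc f ^ (n + n) * (τ v * τ' w - τ w * τ' v)
      = (f ^ n * τ v) * (f ^ n * τ' w) - (f ^ n * τ w) * (f ^ n * τ' v) := by ring
    _ = 0 := by rw [ha, ha, hb, hb]; ring

/-! ### Contraction and exterior multiplication in top degree -/

theorem wedgeOne_apply (α : Module.Dual C E) {k : ℕ} (τ : E [⋀^Fin k]→ₗ[C] C)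
    (v : Fin (k + 1) → E) :
    wedgeOne α τ v = ∑ i : Fin (k + 1), (-1 : C) ^ (i : ℕ) * (α (v i) * τ (i.removeNth v)) := by
  rw [wedgeOne, AlternatingMap.alternatizeUncurryFin_apply]
  refine Finset.sum_congr rfl fun i _ => ?_
  simp [zsmul_eq_mul]

theorem map_update_eq_cons {k : ℕ} (τ : E [⋀^Fin (k + 1)]→ₗ[C] C) (v : Fin (k + 1) → E)
    (i : Fin (k + 1)) (X : E) :
    τ (Function.update v i X) = (-1 : C) ^ (i : ℕ) * τ (Matrix.vecCons X (i.removeNth v)) := by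
  rw [← Fin.insertNth_removeNth, AlternatingMap.map_insertNth]
  simp

theorem removeNth_succ_cons {k : ℕ} (v : Fin (k + 1) → E) (X : E) (i : Fin (k + 1)) :
    i.succ.removeNth (Matrix.vecCons X v) = Matrix.vecCons X (i.removeNth v) := by
  ext j
  refine Fin.cases ?_ (fun j => ?_) j
  · simp [Fin.removeNth_apply]
  · simp [Fin.removeNth_apply]

theorem removeNth_zero_cons {k : ℕ} (v : Fin k → E) (X : E) :
    (0 : Fin (k + 1)).removeNth (Matrix.vecCons X v) = v := by
  ext j
  simp [Fin.removeNth_apply]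

/-- In top degree `β(X) τ = β ∧ i_X τ`, since `β ∧ τ = 0`; evaluated on vectors. -/
theorem HasLocalFrames.exchange {n : ℕ} (hE : HasLocalFrames C E n) (β : Module.Dual C E) (X : E)
    (τ : E [⋀^Fin n]→ₗ[C] C) (v : Fin n → E) :
    ∑ i, β (v i) * τ (Function.update v i X) = β X * τ v := by
  have h := congrArg (fun σ => σ (Matrix.vecCons X v))
    (hE.form_eq_zero (Nat.lt_succ_self n) (wedgeOne β τ))
  simp only [wedgeOne_apply, AlternatingMap.zero_apply, Fin.sum_univ_succ, removeNth_zero_cons] at h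
  rw [← sub_eq_zero, ← neg_eq_zero, neg_sub]
  rw [← h, sub_eq_add_neg, ← Finset.sum_neg_distrib]
  congr 1
  · simp
  · refine Finset.sum_congr rfl fun i _ => ?_
    cases n with
    | zero => exact i.elim0
    | succ k =>
      rw [map_update_eq_cons, removeNth_succ_cons]
      simp only [Matrix.cons_val_succ, Fin.val_succ, pow_succ]
      ring

theorem HasLocalFrames.wedgeOne_curryLeft {k : ℕ} (hE : HasLocalFrames C E (k + 1))
    (β : Module.Dual C E) (X : E) (τ : E [⋀^Fin (k + 1)]→ₗ[C] C) :
    wedgeOne β (τ.curryLeft X) = β X • τ := by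
  ext v
  rw [wedgeOne_apply, AlternatingMap.smul_apply, smul_eq_mul, ← hE.exchange]
  refine Finset.sum_congr rfl fun i _ => ?_
  rw [map_update_eq_cons, AlternatingMap.curryLeft_apply_apply]
  ring

/-! ### Traces on top forms -/

/-- The action `v ↦ ∑ i, τ (v 0, …, T (v i), …, v (k - 1))` of an endomorphism on a form. -/
noncomputable def slotForm {k : ℕ} (τ : E [⋀^Fin k]→ₗ[C] C) (T : E →ₗ[C] E) : E [⋀^Fin k]→ₗ[C] C where
  toFun v := slotSum τ T v
  map_update_add' v j x y := by
    have : ‹DecidableEq (Fin k)› = instDecidableEqFin k := Subsingleton.elim _ _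
    subst this
    exact slotSum_update_add τ T.map_add v j x y
  map_update_smul' v j f x := by
    have : ‹DecidableEq (Fin k)› = instDecidableEqFin k := Subsingleton.elim _ _
    subst this
    rw [slotSum_update_smul τ (D := 0) (fun f x => by simp)]
    simp
  map_eq_zero_of_eq' v i j hv hij := slotSum_eq_zero τ T v hv hij

theorem slotForm_apply {k : ℕ} (τ : E [⋀^Fin k]→ₗ[C] C) (T : E →ₗ[C] E) (v : Fin k → E) :
    slotForm τ T v = ∑ i, τ (Function.update v i (T (v i))) := rfl

theorem slotForm_add {k : ℕ} (τ : E [⋀^Fin k]→ₗ[C] C) (T U : E →ₗ[C] E) :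
    slotForm τ (T + U) = slotForm τ T + slotForm τ U := by
  ext v
  simp [slotForm_apply, Finset.sum_add_distrib]

theorem slotForm_smul {k : ℕ} (τ : E [⋀^Fin k]→ₗ[C] C) (f : C) (T : E →ₗ[C] E) :
    slotForm τ (f • T) = f • slotForm τ T := by
  ext v
  simp [slotForm_apply, Finset.mul_sum]

theorem slotForm_id {k : ℕ} (τ : E [⋀^Fin k]→ₗ[C] C) :
    slotForm τ LinearMap.id = (k : C) • τ := by
  ext v
  simp [slotForm_apply]

/-- The trace of `X ↦ β(X) Z` is `β(Z)`. -/
theorem HasLocalFrames.slotForm_smulRight {n : ℕ} (hE : HasLocalFrames C E n)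
    (τ : E [⋀^Fin n]→ₗ[C] C) (β : Module.Dual C E) (Z : E) :
    slotForm τ (β.smulRight Z) = β Z • τ := by
  ext v
  simp [slotForm_apply, ← hE.exchange β Z τ v]

/-! ### Cartan calculus -/

namespace SkewAlgebroid

variable (S : SkewAlgebroid C E)

theorem lieForm_add_left (X Y : E) {k : ℕ} (τ : E [⋀^Fin k]→ₗ[C] C) :
    S.lieForm (X + Y) τ = S.lieForm X τ + S.lieForm Y τ := by
  ext v
  simp only [lieForm_apply, S.bracket_add_left, AlternatingMap.map_update_add, map_add,
    Derivation.add_apply, Finset.sum_add_distrib, AlternatingMap.add_apply]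
  abel

theorem lieForm_smul_left_of_top {n : ℕ} (hE : HasLocalFrames C E n) (f : C) (X : E)
    (τ : E [⋀^Fin n]→ₗ[C] C) :
    S.lieForm (f • X) τ = f • S.lieForm X τ + S.act X f • τ := by
  ext v
  rw [lieForm_smul_left]
  have h := hE.exchange (S.dFun f) X τ v
  simp only [dFun, LinearMap.coe_mk, AddHom.coe_mk] at h
  rw [h]
  rfl

/-- `[L_Y, i_Z] = i_[Y, Z]`. -/
theorem lieForm_curryLeft (Y Z : E) {k : ℕ} (τ : E [⋀^Fin (k + 1)]→ₗ[C] C) :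
    S.lieForm Y (τ.curryLeft Z) = (S.lieForm Y τ).curryLeft Z + τ.curryLeft (S.bracket Y Z) := by
  ext v
  simp only [AlternatingMap.add_apply, AlternatingMap.curryLeft_apply_apply, lieForm_apply,
    Fin.sum_univ_succ]
  have h0 : Function.update (Matrix.vecCons Z v) 0 (S.bracket Y (Matrix.vecCons Z v 0)) =
      Matrix.vecCons (S.bracket Y Z) v := by
    ext j; refine Fin.cases ?_ (fun j => ?_) j <;> simp
  have h1 : ∀ i : Fin k, Function.update (Matrix.vecCons Z v) i.succ
      (S.bracket Y (Matrix.vecCons Z v i.succ)) =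
      Matrix.vecCons Z (Function.update v i (S.bracket Y (v i))) := by
    intro i
    ext j; refine Fin.cases ?_ (fun j => ?_) j
    · simp [Function.update_of_ne (Fin.succ_ne_zero i).symm]
    · by_cases h : j = i
      · subst h; simp
      · simp [Function.update_of_ne h, Function.update_of_ne (fun h' => h (Fin.succ_injective _ h'))]
  simp only [h0, h1]
  abel

theorem curryLeft_d (X : E) {k : ℕ} (τ : E [⋀^Fin (k + 1)]→ₗ[C] C) :
    (S.d τ).curryLeft X + S.d (τ.curryLeft X) = S.lieForm X τ := by
  ext w
  have hterm : ∀ i : Fin (k + 1),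
      (-1 : C) ^ (i.succ : ℕ) * (S.lieForm (w i) τ (Matrix.vecCons X (i.removeNth w)) +
          S.act (w i) (τ (Matrix.vecCons X (i.removeNth w)))) +
        (-1 : C) ^ (i : ℕ) * (S.lieForm (w i) (τ.curryLeft X) (i.removeNth w) +
          S.act (w i) (τ (Matrix.vecCons X (i.removeNth w)))) =
      -τ (Function.update w i (S.bracket X (w i))) := by
    intro i
    rw [lieForm_curryLeft, AlternatingMap.add_apply, AlternatingMap.curryLeft_apply_apply,
      AlternatingMap.curryLeft_apply_apply, S.bracket_swap X, map_update_eq_cons]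
    have hneg : τ (Matrix.vecCons (-S.bracket (w i) X) (i.removeNth w)) =
        -τ (Matrix.vecCons (S.bracket (w i) X) (i.removeNth w)) := by
      simpa using τ.map_vecCons_smul (i.removeNth w) (-1) (S.bracket (w i) X)
    rw [hneg]
    simp only [Fin.val_succ, pow_succ]
    ring
  have h2 : ∀ T : C, (1 / 2 : ℝ) • (2 * T) = T := fun T => by
    rw [two_mul, ← two_smul ℝ T, smul_smul]; norm_num
  rw [AlternatingMap.add_apply, AlternatingMap.curryLeft_apply_apply, d_eq, d_eq, ← smul_add,
    Fin.sum_univ_succ, add_assoc, ← h2 (S.lieForm X τ w)]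
  congr 1
  simp only [Matrix.cons_val_zero, Matrix.cons_val_succ, removeNth_succ_cons, removeNth_zero_cons,
    AlternatingMap.curryLeft_apply_apply]
  rw [← Finset.sum_add_distrib, Finset.sum_congr rfl fun i _ => hterm i, Finset.sum_neg_distrib,
    lieForm_apply]
  simp
  ring

theorem d_add {k : ℕ} (τ τ' : E [⋀^Fin k]→ₗ[C] C) : S.d (τ + τ') = S.d τ + S.d τ' := by
  ext v
  simp only [d_eq, lieForm_apply, AlternatingMap.add_apply, map_add, ← smul_add]
  rw [← Finset.sum_add_distrib]
  congr 1
  refine Finset.sum_congr rfl fun i _ => ?_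
  rw [Finset.sum_add_distrib]
  ring

end SkewAlgebroid

/-! ### The exterior derivative of `i_P τ` -/

/-- Bivectors are sums of decomposable ones, because `f (X ∧ Y) = (f X) ∧ Y`. -/
theorem bivector_induction {p : ⋀[C]^2 E → Prop}
    (h0 : ∀ Y Z, p (exteriorPower.ιMulti C 2 ![Y, Z]))
    (hadd : ∀ a b, p a → p b → p (a + b)) (P : ⋀[C]^2 E) : p P := by
  suffices h : ∀ f : C, p (f • P) by simpa using h 1
  induction P using SkewAlgebroid.multivector_induction with
  | h0 v =>
    intro f
    have : f • exteriorPower.ιMulti C 2 v = exteriorPower.ιMulti C 2 ![f • v 0, v 1] := by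
      have hv : v = Matrix.vecCons (v 0) ![v 1] := by ext i; fin_cases i <;> rfl
      conv_lhs => rw [hv]
      rw [← AlternatingMap.map_vecCons_smul]
    rw [this]
    exact h0 _ _
  | hadd a b ha hb =>
    intro f
    rw [smul_add]
    exact hadd _ _ (ha f) (hb f)
  | hsmul g a ha =>
    intro f
    rw [smul_smul]
    exact ha _

theorem interiorTwo_add (P Q : ⋀[C]^2 E) {k : ℕ} (τ : E [⋀^Fin (k + 2)]→ₗ[C] C) :
    interiorTwo (P + Q) τ = interiorTwo P τ + interiorTwo Q τ :=
  map_add _ _ _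

theorem interiorTwo_ιMulti (Y Z : E) {k : ℕ} (τ : E [⋀^Fin (k + 2)]→ₗ[C] C) :
    interiorTwo (exteriorPower.ιMulti C 2 ![Y, Z]) τ = (τ.curryLeft Z).curryLeft Y := by
  rw [interiorTwo, liftTwo_ιMulti]
  rfl

theorem wedgeOne_add (α : Module.Dual C E) {k : ℕ} (τ τ' : E [⋀^Fin k]→ₗ[C] C) :
    wedgeOne α (τ + τ') = wedgeOne α τ + wedgeOne α τ' := by
  ext v
  simp [wedgeOne_apply, mul_add, Finset.sum_add_distrib]

theorem wedgeOne_sub (α : Module.Dual C E) {k : ℕ} (τ τ' : E [⋀^Fin k]→ₗ[C] C) :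
    wedgeOne α (τ - τ') = wedgeOne α τ - wedgeOne α τ' := by
  ext v
  simp [wedgeOne_apply, mul_sub, Finset.sum_sub_distrib]

/-- In rank at most one there are no bivectors: every linear functional on `⋀² E` vanishes. -/
theorem HasLocalFrames.bivector_functional_eq_zero {n : ℕ} (hE : HasLocalFrames C E n)
    (hn : n < 2) (g : ⋀[C]^2 E →ₗ[C] C) : g = 0 := by
  rw [← exteriorPower.alternatingMapLinearEquiv.symm.map_eq_zero_iff]
  exact hE.form_eq_zero hn _

namespace SkewAlgebroid

variable (S : SkewAlgebroid C E)

/-- The differential of a one-form as a bilinear map, `X ↦ i_X dα`, that is,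
`dα(X, W) = ρ(X)(α(W)) - ρ(W)(α(X)) - α([X, W])`. -/
noncomputable def dOne (α : Module.Dual C E) : E →ₗ[C] E →ₗ[C] C :=
  LinearMap.mk₂ C (fun X W => S.act X (α W) - S.act W (α X) - α (S.bracket X W))
    (by intros; simp [S.bracket_add_left]; ring)
    (by intros; simp [S.bracket_smul_left]; ring)
    (by intros; simp [S.bracket_add_right]; ring)
    (by intros; simp [S.bracket_smul]; ring)

theorem dOne_apply (α : Module.Dual C E) (X W : E) :
    S.dOne α X W = S.act X (α W) - S.act W (α X) - α (S.bracket X W) := rfl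

theorem dOne_self (α : Module.Dual C E) (X : E) : S.dOne α X X = 0 := by
  simp [dOne_apply, S.bracket_self]

theorem dOne_swap (α : Module.Dual C E) (X W : E) : S.dOne α W X = -S.dOne α X W := by
  rw [dOne_apply, dOne_apply, S.bracket_swap W X, map_neg]
  ring

/-- `dα(P)`, where `dα(Y ∧ Z) = dα(Y, Z)`. -/
noncomputable def dOnePair (α : Module.Dual C E) : ⋀[C]^2 E →ₗ[C] C := liftTwo (S.dOne α) (S.dOne_self α)

theorem dOnePair_ιMulti (α : Module.Dual C E) (Y Z : E) :
    S.dOnePair α (exteriorPower.ιMulti C 2 ![Y, Z]) = S.dOne α Y Z :=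
  liftTwo_ιMulti _ _ _ _

/-- For a form of top degree, `d i_Y i_Z τ = i_[Y, Z] τ + i_Z L_Y τ - i_Y L_Z τ`, by Cartan's formula
and `dτ = 0`. -/
theorem d_curryLeft_curryLeft {k : ℕ} (hE : HasLocalFrames C E (k + 2)) (Y Z : E)
    (τ : E [⋀^Fin (k + 2)]→ₗ[C] C) :
    S.d ((τ.curryLeft Z).curryLeft Y) = τ.curryLeft (S.bracket Y Z) +
      (S.lieForm Y τ).curryLeft Z - (S.lieForm Z τ).curryLeft Y := by
  have h1 := S.curryLeft_d Y (τ.curryLeft Z)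
  have h2 := S.curryLeft_d Z τ
  rw [hE.form_eq_zero (Nat.lt_succ_self _) (S.d τ), AlternatingMap.curryLeft_zero,
    LinearMap.zero_apply, zero_add] at h2
  rw [h2, lieForm_curryLeft] at h1
  rw [eq_sub_iff_add_eq]
  exact (add_comm _ _).trans (h1.trans (add_comm _ _))

/-- `α ∧ d i_P τ = -L_{P^♯ α} τ - dα(P) τ` for a form `τ` of top degree: apply `d` to
`α ∧ i_P τ = i_{P^♯ α} τ` and use `d i_{P^♯ α} τ = L_{P^♯ α} τ` and `dα ∧ i_P τ = -dα(P) τ`. -/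
theorem wedgeDInterior_of_top {n : ℕ} (hE : HasLocalFrames C E n)
    (hsep : ∀ X : E, (∀ β : Module.Dual C E, β X = 0) → X = 0)
    (α : Module.Dual C E) (P : ⋀[C]^2 E) (τ : E [⋀^Fin n]→ₗ[C] C) :
    S.wedgeDInterior α P τ = -S.lieForm (sharp P α) τ - S.dOnePair α P • τ := by
  rcases Nat.lt_or_ge n 2 with hn | hn
  -- In rank at most one the left side is zero by convention, and `P^♯ α` and `dα(P)` vanish.
  · have h0 : S.wedgeDInterior α P τ = 0 := by
      interval_cases n <;> rfl
    have h1 : sharp P α = 0 := hsep _ fun β =>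
      congrArg (fun g => g P)
        (hE.bivector_functional_eq_zero hn (β ∘ₗ (LinearMap.applyₗ α) ∘ₗ sharp))
    have h2 : S.dOnePair α P = 0 :=
      congrArg (fun g => g P) (hE.bivector_functional_eq_zero hn (S.dOnePair α))
    have h3 : S.lieForm 0 τ = 0 := by simpa using S.lieForm_add_left 0 0 τ
    rw [h0, h1, h2, h3]
    simp
  · obtain ⟨k, rfl⟩ := Nat.exists_eq_add_of_le' hn
    change wedgeOne α (S.d (interiorTwo P τ)) = _
    induction P using bivector_induction with
    | h0 Y Z =>
      rw [interiorTwo_ιMulti, d_curryLeft_curryLeft S hE, wedgeOne_sub, wedgeOne_add,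
        hE.wedgeOne_curryLeft, hE.wedgeOne_curryLeft, hE.wedgeOne_curryLeft, sharp_ιMulti,
        dOnePair_ιMulti, sub_eq_add_neg (α Y • Z), ← neg_smul, lieForm_add_left,
        lieForm_smul_left_of_top S hE, lieForm_smul_left_of_top S hE, dOne_apply, map_neg]
      module
    | hadd P Q hP hQ =>
      rw [interiorTwo_add, d_add, wedgeOne_add, hP, hQ, map_add, LinearMap.add_apply,
        lieForm_add_left, map_add, add_smul]
      abel

/-! ### The Lie derivative of the dual algebroid on top multivectors of the dual -/

/-- The trace of `P^♯ ∘ (dα)^♭`. -/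
theorem slotForm_sharp_dOne {n : ℕ} (hE : HasLocalFrames C E n) (α : Module.Dual C E)
    (P : ⋀[C]^2 E) (τ : E [⋀^Fin n]→ₗ[C] C) :
    slotForm τ (sharp P ∘ₗ S.dOne α) = -((2 * S.dOnePair α P) • τ) := by
  induction P using bivector_induction with
  | h0 Y Z =>
    have h : sharp (exteriorPower.ιMulti C 2 ![Y, Z]) ∘ₗ S.dOne α =
        ((S.dOne α).flip Y).smulRight Z + (-1 : C) • ((S.dOne α).flip Z).smulRight Y := by
      ext X
      simp [sharp_ιMulti, sub_eq_add_neg]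
    rw [h, slotForm_add, slotForm_smul, hE.slotForm_smulRight, hE.slotForm_smulRight,
      dOnePair_ιMulti, LinearMap.flip_apply, LinearMap.flip_apply, dOne_swap]
    module
  | hadd P Q hP hQ =>
    rw [map_add, LinearMap.add_comp, slotForm_add, hP, hQ, map_add]
    module

end SkewAlgebroid

theorem derivation_prod {ι : Type*} [DecidableEq ι] (δ : Derivation ℝ C C) (s : Finset ι)
    (g : ι → C) : δ (∏ i ∈ s, g i) = ∑ i ∈ s, ∏ j ∈ s, Function.update g i (δ (g i)) j := by
  induction s using Finset.induction_on with
  | empty => simp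
  | insert a s ha ih =>
    rw [Finset.prod_insert ha, Derivation.leibniz, ih, Finset.sum_insert ha,
      Finset.prod_insert ha, add_comm]
    congr 1
    · rw [Function.update_self, smul_eq_mul, mul_comm]
      congr 1
      refine Finset.prod_congr rfl fun j hj => ?_
      rw [Function.update_of_ne (by rintro rfl; exact ha hj)]
    · rw [smul_eq_mul, Finset.mul_sum]
      refine Finset.sum_congr rfl fun i hi => ?_
      rw [Finset.prod_insert ha, Function.update_of_ne (by rintro rfl; exact ha hi)]

theorem derivation_det {n : ℕ} (δ : Derivation ℝ C C) (A : Matrix (Fin n) (Fin n) C) :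
    δ A.det = ∑ j, (A.updateCol j fun i => δ (A i j)).det := by
  simp only [Matrix.det_apply, map_sum]
  rw [Finset.sum_comm]
  refine Finset.sum_congr rfl fun σ _ => ?_
  rw [← Finset.smul_sum, Units.smul_def, Units.smul_def, map_zsmul, derivation_prod]
  congr 1
  refine Finset.sum_congr rfl fun i _ => Finset.prod_congr rfl fun j _ => ?_
  by_cases h : j = i
  · subst h; simp
  · simp [h]

/-- Both sides are the trace of `adj(A) B`. -/
theorem sum_det_updateCol_eq_sum_det_updateRow {n : ℕ} (A B : Matrix (Fin n) (Fin n) C) :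
    ∑ j, (A.updateCol j fun i => B i j).det = ∑ i, (A.updateRow i (B i)).det := by
  simp only [← Matrix.cramer_apply, ← Matrix.cramer_transpose_apply,
    Matrix.cramer_eq_adjugate_mulVec, ← Matrix.adjugate_transpose, Matrix.mulVec, dotProduct,
    Matrix.transpose_apply]
  exact Finset.sum_comm

theorem toForm_add {k : ℕ} (ν ν' : ⋀[C]^k (Module.Dual C E)) :
    toForm (ν + ν') = toForm ν + toForm ν' := by
  simp [toForm]

theorem toForm_smul {k : ℕ} (f : C) (ν : ⋀[C]^k (Module.Dual C E)) :
    toForm (f • ν) = f • toForm ν := by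
  simp [toForm]

theorem toForm_sum_apply {k : ℕ} {ι : Type*} (s : Finset ι)
    (ν : ι → ⋀[C]^k (Module.Dual C E)) (v : Fin k → E) :
    toForm (∑ i ∈ s, ν i) v = ∑ i ∈ s, toForm (ν i) v := by
  have h : ∀ χ : ⋀[C]^k (Module.Dual C E), toForm χ v =
      exteriorPower.pairingDual C E k χ (exteriorPower.ιMulti C k v) := fun χ => by
    rw [toForm, exteriorPower.alternatingMapLinearEquiv_symm_apply]
    rfl
  simp only [h, map_sum, LinearMap.sum_apply]

theorem toForm_ιMulti {k : ℕ} (β : Fin k → Module.Dual C E) (v : Fin k → E) :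
    toForm (exteriorPower.ιMulti C k β) v = Matrix.det (Matrix.of fun i j => β j (v i)) := by
  rw [toForm, exteriorPower.alternatingMapLinearEquiv_symm_apply]
  exact exteriorPower.pairingDual_ιMulti_ιMulti β v

namespace SkewAlgebroid

variable (S : SkewAlgebroid C E)

/-- Lie derivatives of dual multivectors, regarded as forms. Suppose that the operator `[α, ·]`
on the dual corresponds to `D = [Y, ·] + T` on `E`, with `T` linear over functions, under the Leibniz
rule for the pairing. Then `[α, ·]` acts on multivectors of the dual as `L_Y - T` acts on forms. -/
theorem toForm_lie {n : ℕ} (S' : SkewAlgebroid C (Module.Dual C E)) (α : Module.Dual C E) (Y : E)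
    (T : E →ₗ[C] E) (hact : S'.act α = S.act Y)
    (hD : ∀ (β : Module.Dual C E) (X : E),
      S.act Y (β X) = S'.bracket α β X + β (S.bracket Y X + T X))
    (ν : ⋀[C]^n (Module.Dual C E)) :
    toForm (S'.lie α ν) = S.lieForm Y (toForm ν) - slotForm (toForm ν) T := by
  induction ν using multivector_induction with
  | h0 β =>
    ext v
    have h1 := derivation_det (S.act Y) (Matrix.of fun i j => β j (v i))
    have h2 : ∀ j, ((Matrix.of fun i j => β j (v i)).updateCol j
          fun i => S.act Y ((Matrix.of fun i j => β j (v i)) i j)).det =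
        ((Matrix.of fun i j => β j (v i)).updateCol j fun i => S'.bracket α (β j) (v i)).det +
        ((Matrix.of fun i j => β j (v i)).updateCol j
          fun i => (Matrix.of fun i j => β j (S.bracket Y (v i) + T (v i))) i j).det := by
      intro j
      rw [← Matrix.det_updateCol_add]
      congr 2
      ext i
      simp [hD]
    simp only [h2, Finset.sum_add_distrib] at h1
    rw [sum_det_updateCol_eq_sum_det_updateRow] at h1
    rw [lie_ιMulti, toForm_sum_apply, AlternatingMap.sub_apply, lieForm_apply,
      slotForm_apply, sub_sub, ← Finset.sum_add_distrib, toForm_ιMulti, h1, eq_sub_iff_add_eq]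
    congr 1
    · refine Finset.sum_congr rfl fun j _ => ?_
      rw [toForm_ιMulti]
      congr 1
      ext i l
      by_cases h : l = j
      · subst h; simp
      · simp [h]
    · refine Finset.sum_congr rfl fun i _ => ?_
      rw [← AlternatingMap.map_update_add, toForm_ιMulti]
      congr 1
      ext l j
      by_cases h : l = i
      · subst h; simp
      · simp [h]
  | hadd a b ha hb =>
    rw [lie_add, toForm_add, ha, hb, toForm_add]
    ext v
    simp [lieForm_apply, slotForm_apply, Finset.sum_add_distrib]
    ring
  | hsmul f a ha =>
    rw [lie_smul, toForm_add, toForm_smul, ha, toForm_smul, toForm_smul, hact]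
    ext v
    simp [lieForm_apply, slotForm_apply, ← Finset.mul_sum]
    ring

/-- Under the Leibniz rule for the pairing, `[α, ·]_P` corresponds to `[P^♯ α, ·] + T`, where
`T X = P^♯(i_X dα) - φ(P^♯ α) X - α(X) P^♯ φ + φ(X) P^♯ α` has trace
`-2 dα(P) - (n - 2) φ(P^♯ α)`. -/
theorem toForm_lie_dualAlgebroid {n : ℕ} (hE : HasLocalFrames C E n) (φ α : Module.Dual C E)
    (P : ⋀[C]^2 E) (ν : ⋀[C]^n (Module.Dual C E)) :
    toForm ((S.dualAlgebroid φ P).lie α ν) =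
      S.lieForm (sharp P α) (toForm ν) + (2 * S.dOnePair α P) • toForm ν +
        (((n : C) - 2) * φ (sharp P α)) • toForm ν := by
  rw [S.toForm_lie (S.dualAlgebroid φ P) α (sharp P α)
    (sharp P ∘ₗ S.dOne α + (-φ (sharp P α)) • LinearMap.id + (-1 : C) • α.smulRight (sharp P φ) +
      φ.smulRight (sharp P α)) rfl ?_ ν]
  · rw [slotForm_add, slotForm_add, slotForm_add, slotForm_smul, slotForm_smul, slotForm_id,
      hE.slotForm_smulRight, hE.slotForm_smulRight, slotForm_sharp_dOne S hE, apply_sharp P φ α]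
    module
  · intro β X
    have h1 := apply_sharp P (S.dOne α X) β
    have h2 := apply_sharp P α β
    have h3 := apply_sharp P φ β
    simp only [dOne_apply] at h1
    simp [dualAlgebroid, lieOneTwisted, lieOne, dFunTwisted, dFun, h1, h2, h3,
      S.bracket_swap X]
    ring

end SkewAlgebroid

/-! ### Multivectors of top degree -/

theorem pairing_ιMulti {k : ℕ} (τ : E [⋀^Fin k]→ₗ[C] C) (v : Fin k → E) :
    pairing τ (exteriorPower.ιMulti C k v) = τ v :=
  exteriorPower.alternatingMapLinearEquiv_apply_ιMulti _ _

theorem pairing_add {k : ℕ} (τ : E [⋀^Fin k]→ₗ[C] C) (η η' : ⋀[C]^k E) :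
    pairing τ (η + η') = pairing τ η + pairing τ η' := map_add _ _ _

theorem pairing_smul {k : ℕ} (τ : E [⋀^Fin k]→ₗ[C] C) (f : C) (η : ⋀[C]^k E) :
    pairing τ (f • η) = f * pairing τ η := map_smul _ _ _

theorem pairing_add_left {k : ℕ} (τ τ' : E [⋀^Fin k]→ₗ[C] C) (η : ⋀[C]^k E) :
    pairing (τ + τ') η = pairing τ η + pairing τ' η := by
  simp [pairing]

theorem pairing_smul_left {k : ℕ} (f : C) (τ : E [⋀^Fin k]→ₗ[C] C) (η : ⋀[C]^k E) :
    pairing (f • τ) η = f * pairing τ η := by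
  simp [pairing]

theorem pairing_neg_left {k : ℕ} (τ : E [⋀^Fin k]→ₗ[C] C) (η : ⋀[C]^k E) :
    pairing (-τ) η = -pairing τ η := by
  simp [pairing]

theorem pairing_sub {k : ℕ} (τ : E [⋀^Fin k]→ₗ[C] C) (η η' : ⋀[C]^k E) :
    pairing τ (η - η') = pairing τ η - pairing τ η' := map_sub _ _ _

theorem pairing_sub_left {k : ℕ} (τ τ' : E [⋀^Fin k]→ₗ[C] C) (η : ⋀[C]^k E) :
    pairing (τ - τ') η = pairing τ η - pairing τ' η := by
  simp [pairing]

theorem SkewAlgebroid.act_pairing (S : SkewAlgebroid C E) (X : E) {k : ℕ}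
    (τ : E [⋀^Fin k]→ₗ[C] C) (η : ⋀[C]^k E) :
    S.act X (pairing τ η) = pairing (S.lieForm X τ) η + pairing τ (S.lie X η) := by
  induction η using SkewAlgebroid.multivector_induction with
  | h0 v =>
    have h : pairing τ (S.lie X (exteriorPower.ιMulti C k v)) =
        ∑ i, τ (Function.update v i (S.bracket X (v i))) := by
      rw [S.lie_ιMulti, pairing, map_sum]
      exact Finset.sum_congr rfl fun i _ => pairing_ιMulti _ _
    rw [h, pairing_ιMulti, pairing_ιMulti, S.lieForm_apply]
    ring
  | hadd a b ha hb =>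
    rw [S.lie_add, pairing_add, pairing_add, pairing_add, map_add, ha, hb]
    ring
  | hsmul f a ha =>
    rw [S.lie_smul, pairing_add, pairing_smul, pairing_smul, pairing_smul, pairing_smul,
      Derivation.leibniz, ha, smul_eq_mul, smul_eq_mul]
    ring

theorem HasLocalFrames.pairing_mul_comm {n : ℕ} (hE : HasLocalFrames C E n)
    (τ τ' : E [⋀^Fin n]→ₗ[C] C) (η η' : ⋀[C]^n E) :
    pairing τ η * pairing τ' η' = pairing τ η' * pairing τ' η := by
  induction η using SkewAlgebroid.multivector_induction with
  | h0 v =>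
    induction η' using SkewAlgebroid.multivector_induction with
    | h0 w => simpa only [pairing_ιMulti] using hE.form_mul_comm τ τ' v w
    | hadd a b ha hb => rw [pairing_add, pairing_add, mul_add, add_mul, ha, hb]
    | hsmul f a ha => rw [pairing_smul, pairing_smul, mul_left_comm, ha, mul_assoc]
  | hadd a b ha hb => rw [pairing_add, pairing_add, mul_add, add_mul, ha, hb]
  | hsmul f a ha => rw [pairing_smul, pairing_smul, mul_left_comm, ← ha, mul_assoc]

/-- A top form `τ` and a top multivector `η` give a finite generalized dual basis, up to the factor
`⟨τ, η⟩`: for `η = x₁ ∧ … ∧ x_n` it consists of the `x_i` and the functionals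
`X ↦ τ (x₁, …, X, …, x_n)`. -/
theorem HasLocalFrames.exists_dual_basis {n : ℕ} (hE : HasLocalFrames C E n)
    (τ : E [⋀^Fin n]→ₗ[C] C) (η : ⋀[C]^n E) :
    ∃ (K : Type) (_ : Fintype K) (e : K → E) (θ : K → Module.Dual C E),
      ∀ (X : E) (β : Module.Dual C E), ∑ k, θ k X * β (e k) = pairing τ η * β X := by
  induction η using SkewAlgebroid.multivector_induction with
  | h0 v =>
    refine ⟨Fin n, inferInstance, v, fun i => τ.toMultilinearMap.toLinearMap v i, fun X β => ?_⟩
    rw [pairing_ιMulti, mul_comm, ← hE.exchange]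
    refine Finset.sum_congr rfl fun i _ => ?_
    rw [mul_comm]
    rfl
  | hadd a b ha hb =>
    obtain ⟨K, _, e, θ, h⟩ := ha
    obtain ⟨K', _, e', θ', h'⟩ := hb
    refine ⟨K ⊕ K', inferInstance, Sum.elim e e', Sum.elim θ θ', fun X β => ?_⟩
    rw [Fintype.sum_sum_type, pairing_add, add_mul, ← h, ← h']
    rfl
  | hsmul f a ha =>
    obtain ⟨K, _, e, θ, h⟩ := ha
    refine ⟨K, inferInstance, e, fun k => f • θ k, fun X β => ?_⟩
    rw [pairing_smul, mul_assoc, ← h, Finset.mul_sum]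
    simp [mul_assoc]

theorem HasLocalFrames.eq_zero_of_pairing_eq_zero {n : ℕ} (hE : HasLocalFrames C E n)
    (hsep : ∀ X : E, (∀ β : Module.Dual C E, β X = 0) → X = 0)
    {τ : E [⋀^Fin n]→ₗ[C] C} {η : ⋀[C]^n E} (hτη : pairing τ η = 1)
    (χ : ⋀[C]^n E) (h : ∀ τ' : E [⋀^Fin n]→ₗ[C] C, pairing τ' χ = 0) : χ = 0 := by
  obtain ⟨K, _, e, θ, hθ⟩ := hE.exists_dual_basis τ η
  -- The dual basis exhibits `E` as a direct summand of the free module on `K`.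
  have hid : Fintype.linearCombination C e ∘ₗ LinearMap.pi θ = LinearMap.id := by
    ext X
    rw [← sub_eq_zero]
    refine hsep _ fun β => ?_
    have := hθ X β
    rw [hτη, one_mul] at this
    simp [Fintype.linearCombination_apply, this]
  have : Module.Projective C (⋀[C]^n E) := by
    refine Module.Projective.of_split (exteriorPower.map n (LinearMap.pi θ))
      (exteriorPower.map n (Fintype.linearCombination C e)) ?_
    rw [← exteriorPower.map_comp, hid, exteriorPower.map_id]
  rw [← Module.forall_dual_apply_eq_zero_iff C]
  intro g
  have := h (exteriorPower.alternatingMapLinearEquiv.symm g)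
  rwa [pairing, LinearEquiv.apply_symm_apply] at this

/-- The top exterior power is free of rank one on `η`. -/
theorem HasLocalFrames.eq_pairing_smul {n : ℕ} (hE : HasLocalFrames C E n)
    (hsep : ∀ X : E, (∀ β : Module.Dual C E, β X = 0) → X = 0)
    {τ : E [⋀^Fin n]→ₗ[C] C} {η : ⋀[C]^n E} (hτη : pairing τ η = 1) (χ : ⋀[C]^n E) :
    χ = pairing τ χ • η := by
  rw [← sub_eq_zero]
  refine hE.eq_zero_of_pairing_eq_zero hsep hτη _ fun τ' => ?_
  have h := hE.pairing_mul_comm τ τ' η χ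
  rw [hτη, one_mul] at h
  rw [pairing_sub, pairing_smul, h, sub_self]

/-- The multivector `η` as a form on the dual. -/
noncomputable def bidualForm {k : ℕ} (η : ⋀[C]^k E) : Module.Dual C E [⋀^Fin k]→ₗ[C] C :=
  toForm (exteriorPower.map k (Module.Dual.eval C E) η)

theorem pairing_bidualForm {k : ℕ} (η : ⋀[C]^k E) (ν : ⋀[C]^k (Module.Dual C E)) :
    pairing (bidualForm η) ν = pairing (toForm ν) η := by
  induction η using SkewAlgebroid.multivector_induction with
  | h0 v =>
    induction ν using SkewAlgebroid.multivector_induction with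
    | h0 β =>
      rw [bidualForm, exteriorPower.map_apply_ιMulti, pairing_ιMulti, pairing_ιMulti, toForm_ιMulti,
        toForm_ιMulti, ← Matrix.det_transpose]
      rfl
    | hadd a b ha hb => rw [pairing_add, toForm_add, pairing_add_left, ha, hb]
    | hsmul f a ha => rw [pairing_smul, toForm_smul, pairing_smul_left, ha]
  | hadd a b ha hb =>
    rw [pairing_add, ← ha, ← hb, bidualForm, map_add, toForm_add, pairing_add_left]
    rfl
  | hsmul f a ha =>
    rw [pairing_smul, ← ha, bidualForm, map_smul, toForm_smul, pairing_smul_left]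
    rfl

theorem eq_zero_of_dual_dual_apply_eq_zero (β : Module.Dual C E)
    (h : ∀ Ψ : Module.Dual C (Module.Dual C E), Ψ β = 0) : β = 0 := by
  ext X
  exact h (Module.Dual.eval C E X)

namespace SkewAlgebroid

variable (S : SkewAlgebroid C E)

theorem pairing_lie {k : ℕ} {τ : E [⋀^Fin k]→ₗ[C] C} {η : ⋀[C]^k E} (hτη : pairing τ η = 1)
    (X : E) : pairing τ (S.lie X η) = -pairing (S.lieForm X τ) η := by
  have h := S.act_pairing X τ η
  rw [hτη, Derivation.map_one_eq_zero] at h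
  rw [eq_neg_iff_add_eq_zero, add_comm, ← h]

/-- The divergences of `α` and of `P^♯ α` with respect to `ν` and `η`. -/
theorem pairing_lie_dualAlgebroid {n : ℕ} (hE : HasLocalFrames C E n)
    (hsep : ∀ X : E, (∀ β : Module.Dual C E, β X = 0) → X = 0)
    (φ α : Module.Dual C E) (P : ⋀[C]^2 E) {η : ⋀[C]^n E} {ν : ⋀[C]^n (Module.Dual C E)}
    (hην : pairing (toForm ν) η = 1) :
    pairing (bidualForm η) ((S.dualAlgebroid φ P).lie α ν) =
      pairing (toForm ν) (S.lie (sharp P α) η) -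
        2 * pairing (S.wedgeDInterior α P (toForm ν)) η + ((n : C) - 2) * φ (sharp P α) := by
  rw [pairing_bidualForm, S.toForm_lie_dualAlgebroid hE, S.wedgeDInterior_of_top hE hsep,
    S.pairing_lie hην]
  simp only [pairing_add_left, pairing_sub_left, pairing_smul_left, pairing_neg_left, hην]
  ring

end SkewAlgebroid

end Algebra

section Manifold

/-! ### Modular forms -/

variable {m : ℕ} {M : Type*} [TopologicalSpace M] [ChartedSpace (EuclideanSpace ℝ (Fin m)) M]
  [IsManifold (𝓡 m) ∞ M]

theorem IsVolumeForm.smul_left_injective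
    {μ : VectorField m M [⋀^Fin m]→ₗ[SmoothFun m M] SmoothFun m M} (hμ : IsVolumeForm μ)
    {c c' : SmoothFun m M} (h : c • μ = c' • μ) : c = c' := by
  ext x
  obtain ⟨X, hX⟩ := hμ x
  have h1 : c x * μ X x = c' x * μ X x := congrArg (fun τ => τ X x) h
  exact mul_right_cancel₀ hX h1

/-- The quotient of a top form by a volume form is smooth: near a point it is `σ(X) / μ(X)` for a
fixed tuple `X` of vector fields. -/
theorem IsVolumeForm.exists_eq_smul
    {μ : VectorField m M [⋀^Fin m]→ₗ[SmoothFun m M] SmoothFun m M} (hμ : IsVolumeForm μ)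
    (hM : HasLocalFrames (SmoothFun m M) (VectorField m M) m)
    (σ : VectorField m M [⋀^Fin m]→ₗ[SmoothFun m M] SmoothFun m M) :
    ∃ c : SmoothFun m M, σ = c • μ := by
  choose X hX using hμ
  have hcomm : ∀ (Y Z : Fin m → VectorField m M) (x : M), σ Y x * μ Z x = σ Z x * μ Y x :=
    fun Y Z x => congrArg (fun f : SmoothFun m M => f x) (hM.form_mul_comm σ μ Y Z)
  refine ⟨⟨fun x => σ (X x) x / μ (X x) x, fun x => ?_⟩, ?_⟩
  · have h1 : ContMDiffAt (𝓡 m) 𝓘(ℝ, ℝ) ∞ (fun y => σ (X x) y / μ (X x) y) x :=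
      ((σ (X x)).contMDiff x).div₀ ((μ (X x)).contMDiff x) (hX x)
    refine h1.congr_of_eventuallyEq ?_
    filter_upwards [(μ (X x)).contMDiff.continuous.continuousAt.eventually_ne (hX x)] with y hy
    rw [div_eq_div_iff (hX y) hy]
    exact hcomm _ _ y
  · ext Y x
    change σ Y x = σ (X x) x / μ (X x) x * μ Y x
    rw [div_mul_eq_mul_div, eq_div_iff (hX x)]
    exact hcomm _ _ x

section

variable {E : Type*} [AddCommGroup E] [Module (SmoothFun m M) E]
  {S : SkewAlgebroid (SmoothFun m M) E} {ρ : E →ₗ[SmoothFun m M] VectorField m M} {n : ℕ}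
  {η : ⋀[SmoothFun m M]^n E} {τ : E [⋀^Fin n]→ₗ[SmoothFun m M] SmoothFun m M}
  {μ : VectorField m M [⋀^Fin m]→ₗ[SmoothFun m M] SmoothFun m M}

/-- The value `⟨ξ, X⟩` of a modular form is the sum of the divergences of `X` and `ρ(X)`. -/
theorem IsModularForm.apply_eq (hμ : IsVolumeForm μ) (hτη : pairing τ η = 1)
    {ξ : Module.Dual (SmoothFun m M) E} (hξ : IsModularForm S ρ η μ ξ) (X : E)
    {c : SmoothFun m M} (hc : (tangentAlgebroid m M).lieForm (ρ X) μ = c • μ) :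
    ξ X = pairing τ (S.lie X η) + c := by
  let g := exteriorPower.alternatingMapLinearEquiv τ
  have hg : g η = 1 := hτη
  have h := congrArg (fun t => TensorProduct.lid (SmoothFun m M) _
    (g.rTensor (VectorField m M [⋀^Fin m]→ₗ[SmoothFun m M] SmoothFun m M) t)) (hξ X)
  simp only [map_add, map_smul, LinearMap.rTensor_tmul, TensorProduct.lid_tmul, hg, one_smul,
    hc] at h
  refine hμ.smul_left_injective ?_
  rw [add_smul, h]
  rfl

theorem existsUnique_isModularForm (hE : HasLocalFrames (SmoothFun m M) E n)
    (hsep : ∀ X : E, (∀ β : Module.Dual (SmoothFun m M) E, β X = 0) → X = 0)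
    (hM : HasLocalFrames (SmoothFun m M) (VectorField m M) m)
    (hact : S.act = VectorField.deriv ∘ₗ ρ) (hμ : IsVolumeForm μ) (hτη : pairing τ η = 1) :
    ∃! ξ, IsModularForm S ρ η μ ξ := by
  choose c hc using fun X : VectorField m M =>
    hμ.exists_eq_smul hM ((tangentAlgebroid m M).lieForm X μ)
  have hc_add : ∀ X Y, c (X + Y) = c X + c Y := fun X Y => by
    refine hμ.smul_left_injective ?_
    rw [add_smul, ← hc, ← hc, ← hc, SkewAlgebroid.lieForm_add_left]
  have hc_smul : ∀ f X, c (f • X) = f * c X + VectorField.deriv X f := fun f X => by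
    refine hμ.smul_left_injective ?_
    rw [add_smul, mul_smul, ← hc, ← hc, SkewAlgebroid.lieForm_smul_left_of_top _ hM]
    rfl
  let ξ : Module.Dual (SmoothFun m M) E :=
    { toFun := fun X => pairing τ (S.lie X η) + c (ρ X)
      map_add' := fun X Y => by
        rw [S.pairing_lie hτη, S.pairing_lie hτη, S.pairing_lie hτη, S.lieForm_add_left,
          pairing_add_left, map_add, hc_add]
        ring
      map_smul' := fun f X => by
        -- The derivative terms of the two divergences cancel.
        rw [S.pairing_lie hτη, S.pairing_lie hτη, S.lieForm_smul_left_of_top hE,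
          pairing_add_left, pairing_smul_left, pairing_smul_left, hτη, map_smul, hc_smul, hact,
          LinearMap.comp_apply, RingHom.id_apply, smul_eq_mul]
        ring }
  have hξ : IsModularForm S ρ η μ ξ := fun X => by
    have h1 : S.lie X η = pairing τ (S.lie X η) • η := hE.eq_pairing_smul hsep hτη _
    rw [hc, h1, TensorProduct.tmul_smul, ← TensorProduct.smul_tmul', ← add_smul]
    rfl
  refine ⟨ξ, hξ, fun ξ' hξ' => ?_⟩
  ext1 X
  rw [hξ'.apply_eq hμ hτη X (hc _), hξ.apply_eq hμ hτη X (hc _)]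

end

end Manifold

section Manifold

/-! ### Local frames of a vector bundle -/

variable {m : ℕ} {M : Type*} [TopologicalSpace M] [T2Space M]
  [ChartedSpace (EuclideanSpace ℝ (Fin m)) M] [IsManifold (𝓡 m) ∞ M]
  {F : Type*} [NormedAddCommGroup F] [NormedSpace ℝ F] [FiniteDimensional ℝ F]
  {V : M → Type*} [TopologicalSpace (TotalSpace F V)]
  [∀ x, AddCommGroup (V x)] [∀ x, Module ℝ (V x)] [∀ x, TopologicalSpace (V x)]
  [FiberBundle F V] [VectorBundle ℝ F V] [ContMDiffVectorBundle ∞ F V (𝓡 m)]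

/-- A local frame and its dual frame near `x`, both multiplied by a bump function `χ`; then the
factor `f` is `χ²`. -/
theorem exists_localized_frame {n : ℕ} (hn : Module.finrank ℝ F = n) (x : M) :
    ∃ (f : SmoothFun m M) (s : Fin n → Cₛ^∞⟮𝓡 m; F, V⟯)
      (θ : Fin n → Module.Dual (SmoothFun m M) Cₛ^∞⟮𝓡 m; F, V⟯),
      f x ≠ 0 ∧ ∀ X, f • X = ∑ i, θ i X • s i := by
  let e := trivializationAt F V x
  let b := Module.finBasisOfFinrankEq ℝ F hn
  obtain ⟨χ, -, hχ⟩ := (SmoothBumpFunction.nhds_basis_tsupport (I := 𝓡 m) x).mem_iff.mp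
    (e.open_baseSet.mem_nhds (FiberBundle.mem_baseSet_trivializationAt F V x))
  let c : Fin n → (y : M) → V y →ₗ[ℝ] ℝ := fun i => e.localFrameCoeff (𝓡 m) b i
  have hsmooth : ∀ (i : Fin n) (X : Cₛ^∞⟮𝓡 m; F, V⟯),
      ContMDiff (𝓡 m) 𝓘(ℝ, ℝ) ∞ fun y => χ y * c i y (X y) := by
    intro i X
    refine contMDiff_of_tsupport fun y hy => ?_
    have hy' : y ∈ e.baseSet := hχ (tsupport_mul_subset_left hy)
    exact χ.contMDiffAt.mul (contMDiffAt_localFrameCoeff b hy' (X.contMDiff y) i)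
  let s : Fin n → Cₛ^∞⟮𝓡 m; F, V⟯ := fun i => ⟨⇑χ • e.localFrame b i,
    ContMDiffOn.smul_section_of_tsupport χ.contMDiff.contMDiffOn e.open_baseSet hχ
      (e.contMDiffOn_localFrame_baseSet ∞ b i)⟩
  let θ : Fin n → Module.Dual (SmoothFun m M) Cₛ^∞⟮𝓡 m; F, V⟯ := fun i =>
    { toFun := fun X => ⟨fun y => χ y * c i y (X y), hsmooth i X⟩
      map_add' := fun X Y => by
        ext y
        change χ y * c i y (X y + Y y) = χ y * c i y (X y) + χ y * c i y (Y y)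
        rw [map_add, mul_add]
      map_smul' := fun g X => by
        ext y
        change χ y * c i y (g y • X y) = g y * (χ y * c i y (X y))
        rw [map_smul, smul_eq_mul]
        ring }
  refine ⟨⟨fun y => χ y * χ y, χ.contMDiff.mul χ.contMDiff⟩, s, θ, ?_, fun X => ?_⟩
  · change χ x * χ x ≠ 0
    rw [χ.eq_one]
    norm_num
  · ext y
    have h1 : (∑ i, θ i X • s i) y = ∑ i, (χ y * c i y (X y)) • (χ y • e.localFrame b i y) := by
      have : ∀ t : Finset (Fin n), (∑ i ∈ t, θ i X • s i) y =
          ∑ i ∈ t, (χ y * c i y (X y)) • (χ y • e.localFrame b i y) := by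
        intro t
        induction t using Finset.induction_on with
        | empty => rfl
        | insert i t hi ih =>
          rw [Finset.sum_insert hi, Finset.sum_insert hi, ← ih]
          rfl
      exact this _
    rw [h1]
    change (χ y * χ y) • X y = _
    by_cases hy : χ y = 0
    · simp [hy]
    · have hy' : y ∈ e.baseSet := hχ (subset_tsupport _ hy)
      conv_lhs => rw [e.eq_sum_localFrameCoeff_smul (I := 𝓡 m) (b := b) (s := X) hy']
      rw [Finset.smul_sum]
      refine Finset.sum_congr rfl fun i _ => ?_
      rw [smul_smul, smul_smul]
      congr 1
      ring

theorem hasLocalFrames_section {n : ℕ} (hn : Module.finrank ℝ F = n) :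
    HasLocalFrames (SmoothFun m M) Cₛ^∞⟮𝓡 m; F, V⟯ n := by
  intro c hc
  ext x
  obtain ⟨f, s, θ, hf, h⟩ := exists_localized_frame (m := m) (F := F) (V := V) hn x
  obtain ⟨N, hN⟩ := hc f s θ h
  have hpow : ∀ N : ℕ, (f ^ N) x = f x ^ N := by
    intro N
    induction N with
    | zero => rfl
    | succ k ih => rw [pow_succ, pow_succ, ← ih]; rfl
  have h1 : (f ^ N) x * c x = 0 := congrArg (fun g : SmoothFun m M => g x) hN
  rw [hpow] at h1
  exact (mul_eq_zero.mp h1).resolve_left (pow_ne_zero N hf)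

theorem section_eq_zero_of_dual_apply_eq_zero (X : Cₛ^∞⟮𝓡 m; F, V⟯)
    (h : ∀ β : Module.Dual (SmoothFun m M) Cₛ^∞⟮𝓡 m; F, V⟯, β X = 0) : X = 0 := by
  ext x
  obtain ⟨f, s, θ, hf, hX⟩ := exists_localized_frame (m := m) (F := F) (V := V) rfl x
  have h1 : f • X = 0 := by rw [hX X]; simp [h]
  have h2 : f x • X x = 0 := congrArg (fun Y : Cₛ^∞⟮𝓡 m; F, V⟯ => Y x) h1
  exact (smul_eq_zero.mp h2).resolve_left hf

theorem hasLocalFrames_vectorField :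
    HasLocalFrames (SmoothFun m M) (VectorField m M) m :=
  hasLocalFrames_section (V := (TangentSpace (𝓡 m) : M → Type)) (by simp)

/-! ### Modular forms of triangular Lie and Jacobi bialgebroids -/

/-- The modular form of the skew algebroid on the dual defined by a bivector and a one-form, and its
relation to the modular form of `A`; `φ = 0` gives the Lie case. -/
theorem LieAlgebroid.isModularForm_dualAlgebroid {n : ℕ} (hn : Module.finrank ℝ F = n)
    (A : LieAlgebroid m F V) {η : ⋀[SmoothFun m M]^n Cₛ^∞⟮𝓡 m; F, V⟯}
    {ν : ⋀[SmoothFun m M]^n (Module.Dual (SmoothFun m M) Cₛ^∞⟮𝓡 m; F, V⟯)}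
    (hην : pairing (toForm ν) η = 1)
    {μ : VectorField m M [⋀^Fin m]→ₗ[SmoothFun m M] SmoothFun m M} (hμ : IsVolumeForm μ)
    (φ : Module.Dual (SmoothFun m M) Cₛ^∞⟮𝓡 m; F, V⟯)
    (P : ⋀[SmoothFun m M]^2 Cₛ^∞⟮𝓡 m; F, V⟯) :
    (∃! ζ, IsModularForm (A.toSkew.dualAlgebroid φ P) (A.anchor ∘ₗ sharp P) ν μ ζ) ∧
    ∀ ξ ζ, IsModularForm A.toSkew A.anchor η μ ξ →
      IsModularForm (A.toSkew.dualAlgebroid φ P) (A.anchor ∘ₗ sharp P) ν μ ζ →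
      ∀ α : Module.Dual (SmoothFun m M) Cₛ^∞⟮𝓡 m; F, V⟯,
        α (sharp P ξ) = -ζ α - ((n : SmoothFun m M) - 2) * α (sharp P φ) -
          2 * pairing (A.toSkew.wedgeDInterior α P (toForm ν)) η := by
  have hE : HasLocalFrames (SmoothFun m M) Cₛ^∞⟮𝓡 m; F, V⟯ n := hasLocalFrames_section hn
  have hην' : pairing (bidualForm η) ν = 1 := by rw [pairing_bidualForm, hην]
  refine ⟨existsUnique_isModularForm hE.dual eq_zero_of_dual_dual_apply_eq_zero
    hasLocalFrames_vectorField rfl hμ hην', fun ξ ζ hξ hζ α => ?_⟩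
  obtain ⟨c, hc⟩ := hμ.exists_eq_smul hasLocalFrames_vectorField
    ((tangentAlgebroid m M).lieForm (A.anchor (sharp P α)) μ)
  have h1 := hξ.apply_eq hμ hην (sharp P α) hc
  have h2 := hζ.apply_eq hμ hην' α hc
  rw [A.toSkew.pairing_lie_dualAlgebroid hE section_eq_zero_of_dual_apply_eq_zero φ α P hην] at h2
  rw [apply_sharp P ξ α, apply_sharp P φ α, h1, h2]
  ring

end Manifold

end LieAlgd

theorem mainTheorem12 {m n : ℕ} {M : Type*} [TopologicalSpace M] [T2Space M]
    [SecondCountableTopology M] [ChartedSpace (EuclideanSpace ℝ (Fin m)) M]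
    [IsManifold (𝓡 m) ∞ M]
    {F : Type*} [NormedAddCommGroup F] [NormedSpace ℝ F] [FiniteDimensional ℝ F]
    {V : M → Type*} [TopologicalSpace (TotalSpace F V)]
    [∀ x, AddCommGroup (V x)] [∀ x, Module ℝ (V x)] [∀ x, TopologicalSpace (V x)]
    [FiberBundle F V] [VectorBundle ℝ F V] [ContMDiffVectorBundle ∞ F V (𝓡 m)]
    (hn : Module.finrank ℝ F = n)
    (A : LieAlgd.LieAlgebroid m F V)
    (η : ⋀[LieAlgd.SmoothFun m M]^n Cₛ^∞⟮𝓡 m; F, V⟯)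
    (ν : ⋀[LieAlgd.SmoothFun m M]^n
      (Module.Dual (LieAlgd.SmoothFun m M) Cₛ^∞⟮𝓡 m; F, V⟯))
    (hην : LieAlgd.pairing (LieAlgd.toForm ν) η = 1)
    (μ : LieAlgd.VectorField m M [⋀^Fin m]→ₗ[LieAlgd.SmoothFun m M] LieAlgd.SmoothFun m M)
    (hμ : LieAlgd.IsVolumeForm μ) :
    -- the modular form of `A`
    (∃! ξ, LieAlgd.IsModularForm A.toSkew A.anchor η μ ξ) ∧
    -- triangular Lie bialgebroids
    (∀ P : ⋀[LieAlgd.SmoothFun m M]^2 Cₛ^∞⟮𝓡 m; F, V⟯, A.toSkew.IsPoisson P →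
      (∃! ζ, LieAlgd.IsModularForm (A.toSkew.poissonDual P)
        (A.anchor ∘ₗ LieAlgd.sharp P) ν μ ζ) ∧
      ∀ ξ ζ, LieAlgd.IsModularForm A.toSkew A.anchor η μ ξ →
        LieAlgd.IsModularForm (A.toSkew.poissonDual P) (A.anchor ∘ₗ LieAlgd.sharp P) ν μ ζ →
        ∀ α : Module.Dual (LieAlgd.SmoothFun m M) Cₛ^∞⟮𝓡 m; F, V⟯,
          α (LieAlgd.sharp P ξ) =
            -ζ α - 2 * LieAlgd.pairing (A.toSkew.wedgeDInterior α P (LieAlgd.toForm ν)) η) ∧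
    -- triangular Jacobi bialgebroids
    (∀ (φ : Module.Dual (LieAlgd.SmoothFun m M) Cₛ^∞⟮𝓡 m; F, V⟯)
      (P : ⋀[LieAlgd.SmoothFun m M]^2 Cₛ^∞⟮𝓡 m; F, V⟯),
      A.toSkew.IsCocycle φ → A.toSkew.IsJacobi φ P →
      (∃! ζ, LieAlgd.IsModularForm (A.toSkew.dualAlgebroid φ P)
        (A.anchor ∘ₗ LieAlgd.sharp P) ν μ ζ) ∧
      ∀ ξ ζ, LieAlgd.IsModularForm A.toSkew A.anchor η μ ξ →
        LieAlgd.IsModularForm (A.toSkew.dualAlgebroid φ P) (A.anchor ∘ₗ LieAlgd.sharp P) ν μ ζ →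
        ∀ X₀ : Cₛ^∞⟮𝓡 m; F, V⟯, X₀ = -LieAlgd.sharp P φ →
        ∀ ζX : Module.Dual (LieAlgd.SmoothFun m M)
            (Module.Dual (LieAlgd.SmoothFun m M) Cₛ^∞⟮𝓡 m; F, V⟯),
          ζX = LieAlgd.jacobiModularForm n (Module.Dual.eval (LieAlgd.SmoothFun m M) _ X₀) ζ →
        ∀ α : Module.Dual (LieAlgd.SmoothFun m M) Cₛ^∞⟮𝓡 m; F, V⟯,
          α (LieAlgd.sharp P ξ) = -ζX α - α X₀ -
              2 * LieAlgd.pairing (A.toSkew.wedgeDInterior α P (LieAlgd.toForm ν)) η ∧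
          α (LieAlgd.sharp P ξ) = -ζ α + ((n : LieAlgd.SmoothFun m M) - 2) * α X₀ -
              2 * LieAlgd.pairing (A.toSkew.wedgeDInterior α P (LieAlgd.toForm ν)) η ∧
          α (LieAlgd.sharp P (LieAlgd.jacobiModularForm n φ ξ)) =
            -ζX α + ((n : LieAlgd.SmoothFun m M) - 2) * α X₀ -
              2 * LieAlgd.pairing (A.toSkew.wedgeDInterior α P (LieAlgd.toForm ν)) η) := by
  refine ⟨LieAlgd.existsUnique_isModularForm (LieAlgd.hasLocalFrames_section hn)
    LieAlgd.section_eq_zero_of_dual_apply_eq_zero LieAlgd.hasLocalFrames_vectorField rfl hμ hην,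
    fun P _ => ?_, fun φ P _ _ => ?_⟩
  · obtain ⟨h1, h2⟩ := A.isModularForm_dualAlgebroid hn hην hμ 0 P
    refine ⟨h1, fun ξ ζ hξ hζ α => ?_⟩
    rw [h2 ξ ζ hξ hζ α, map_zero, map_zero, mul_zero, sub_zero]
  · obtain ⟨h1, h2⟩ := A.isModularForm_dualAlgebroid hn hην hμ φ P
    refine ⟨h1, ?_⟩
    rintro ξ ζ hξ hζ X₀ rfl ζX rfl α
    have h := h2 ξ ζ hξ hζ α
    simp only [LieAlgd.jacobiModularForm, map_sub, map_smul, map_neg, LinearMap.sub_apply,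
      LinearMap.smul_apply, LinearMap.neg_apply, Module.Dual.eval_apply, smul_eq_mul, h]
    exact ⟨by ring, by ring, by ring⟩
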